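/- Let $F_3$ be the free group of rank $3$. For a basis $\{a_1,a_2,a_3\}$ of $F_3$ and $i\neq j$, the Nielsen transformations $\lambda_{ij},\rho_{ij}\in\mathrm{Aut}(F_3)$ with respect to this basis are given by $\lambda_{ij}(a_i)=a_ja_i$, $\rho_{ij}(a_i)=a_ia_j$ and $\lambda_{ij}(a_k)=\rho_{ij}(a_k)=a_k$ for $k\neq i$. A Nielsen $\mathbb Z^4$ is a subgroup of $\mathrm{Aut}(F_3)$ that is isomorphic to $\mathbb Z^4$ and is generated by Nielsen transformations with respect to one basis of $F_3$ (for example $\langle\lambda_{21},\rho_{21},\lambda_{31},\rho_{31}\rangle$). An isometry $\gamma$ of a metric space $X$ is semisimple if $x\mapsto d(x,\gamma x)$ attains its infimum on $X$. A rhombic dodecahedron is the image, under a similarity of Euclidean space $\mathbb E^3$, of the convex hull of the six points $\pm e_i$ and the eight points $(\pm\frac12,\pm\frac12,\pm\frac12)$. The Dirichlet domain, centred at $o\in\mathbb E^3$, of a group of translations of $\mathbb E^3$ with set of translation vectors $T$ is $\{x\in\mathbb E^3 : d(x,o)\le d(x,o+a)\text{ for all }a\in T\}$. **Theorem.** Let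 $\mathrm{Aut}(F_3)$ act by semisimple isometries on a complete CAT(0) space $X$. Then either every Nielsen transformation (with respect to any basis of $F_3$) fixes a point of $X$, or for every Nielsen $\mathbb Z^4$, say $H\subset\mathrm{Aut}(F_3)$, there is an isometric embedding $\iota:\mathbb E^3\to X$ whose image is $H$-invariant and on which $H$ acts by translations, that is, there is a homomorphism $\tau:H\to\mathbb R^3$ with $h\cdot\iota(x)=\iota(x+\tau(h))$ for all $h\in H$ and $x\in\mathbb E^3$; moreover $\tau(H)$ is a discrete subgroup of $\mathbb R^3$, and the Dirichlet domain of this group of translations, centred at any point of $\mathbb E^3$, is a rhombic dodecahedron. -/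

import Mathlib

/-! ### CAT(0) spaces -/

/-- `c`, restricted to `[0, dist x y]`, is a geodesic path from `x` to `y`
(parametrized by arc length). -/
def IsGeodesicPath {X : Type*} [MetricSpace X] (c : ℝ → X) (x y : X) : Prop :=
  c 0 = x ∧ c (dist x y) = y ∧
    ∀ s ∈ Set.Icc 0 (dist x y), ∀ t ∈ Set.Icc 0 (dist x y), dist (c s) (c t) = |s - t|

/-- A metric space is CAT(0) if it is geodesic and geodesic triangles are no fatter than their
comparison triangles in the Euclidean plane: if `x = c s` and `y = c' t` are points on two sides
`[p, q]` and `[p, r]` of a geodesic triangle, `p' q' r'` is a comparison triangle, and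
`x' ∈ [p', q']`, `y' ∈ [p', r']` are the comparison points, then `dist x y ≤ dist x' y'`.
(Any two distinct sides of a triangle have a common vertex, which is called `p` here; for two
points on the same side the inequality is automatic.) -/
structure IsCAT0 (X : Type*) [MetricSpace X] : Prop where
  exists_geodesic : ∀ x y : X, ∃ c : ℝ → X, IsGeodesicPath c x y
  comparison : ∀ (p q r : X) (c c' : ℝ → X), IsGeodesicPath c p q → IsGeodesicPath c' p r →
    ∀ s ∈ Set.Icc 0 (dist p q), ∀ t ∈ Set.Icc 0 (dist p r),
    ∀ p' q' r' x' y' : EuclideanSpace ℝ (Fin 2),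
      dist p' q' = dist p q → dist p' r' = dist p r → dist q' r' = dist q r →
      dist p' x' = s → dist x' q' = dist p q - s →
      dist p' y' = t → dist y' r' = dist p r - t →
      dist (c s) (c' t) ≤ dist x' y'

/-! ### Semisimple isometries -/

/-- The translation length `inf_x d(x, f x)`. -/
noncomputable def translationLength {X : Type*} [MetricSpace X] (f : X → X) : ℝ :=
  ⨅ x, dist x (f x)

/-- `Min(f)`, the set of points at which the translation length is attained. -/
def minSet {X : Type*} [MetricSpace X] (f : X → X) : Set X :=
  {x | dist x (f x) = translationLength f}

/-- An isometry `f` is semisimple if `Min(f)` is non-empty. -/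
def IsSemisimpleIsometry {X : Type*} [MetricSpace X] (f : X → X) : Prop :=
  Isometry f ∧ (minSet f).Nonempty

/-! ### Nielsen transformations of the free group of rank three -/

/-- `φ` is one of the Nielsen transformations with respect to the basis `b = (b 0, b 1, b 2)`:
for some `i ≠ j` it maps `b i` to `b j * b i` (left) or to `b i * b j` (right), and it fixes the
other two basis elements. -/
def IsNielsenTransformation (b : FreeGroupBasis (Fin 3) (FreeGroup (Fin 3)))
    (φ : MulAut (FreeGroup (Fin 3))) : Prop :=
  ∃ i j : Fin 3, i ≠ j ∧ (φ (b i) = b j * b i ∨ φ (b i) = b i * b j) ∧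
    ∀ k, k ≠ i → φ (b k) = b k

/-- `H` is a Nielsen `ℤ⁴`: a free abelian subgroup of rank four of the automorphism group (the
largest possible rank) that is generated by Nielsen transformations with respect to some basis. -/
def IsNielsenZ4 (H : Subgroup (MulAut (FreeGroup (Fin 3)))) : Prop :=
  (∃ (b : FreeGroupBasis (Fin 3) (FreeGroup (Fin 3))) (S : Set (MulAut (FreeGroup (Fin 3)))),
    (∀ φ ∈ S, IsNielsenTransformation b φ) ∧ H = Subgroup.closure S) ∧
  Nonempty (H ≃* Multiplicative (Fin 4 → ℤ))

/-! ### Dirichlet domains and the rhombic dodecahedron -/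

/-- The Dirichlet domain centred at `o` of a group of translations of Euclidean 3-space
with set of translation vectors `T`. -/
def dirichletDomain (T : Set (EuclideanSpace ℝ (Fin 3))) (o : EuclideanSpace ℝ (Fin 3)) :
    Set (EuclideanSpace ℝ (Fin 3)) :=
  {x | ∀ a ∈ T, dist x o ≤ dist x (o + a)}

/-- The rhombic dodecahedron at the vertex `0` of the tiling of `ℝ³` by unit cubes: the convex
hull of the endpoints `±eᵢ` of the six edges at `0` and the centres `(±1/2, ±1/2, ±1/2)`
of the eight cubes at `0`. -/
noncomputable def stdRhombicDodecahedron : Set (EuclideanSpace ℝ (Fin 3)) :=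
  convexHull ℝ
    ({x | ∃ i, x = EuclideanSpace.single i (1 : ℝ) ∨ x = EuclideanSpace.single i (-1 : ℝ)} ∪
      {x | ∀ i, x i = 1 / 2 ∨ x i = -1 / 2})

/-- A rhombic dodecahedron: the image of the standard one under a similarity
`x ↦ v + r • A x` of Euclidean 3-space. -/
def IsRhombicDodecahedron (P : Set (EuclideanSpace ℝ (Fin 3))) : Prop :=
  ∃ (v : EuclideanSpace ℝ (Fin 3)) (r : ℝ)
    (A : EuclideanSpace ℝ (Fin 3) ≃ₗᵢ[ℝ] EuclideanSpace ℝ (Fin 3)),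
    0 < r ∧ P = (fun x => v + r • A x) '' stdRhombicDodecahedron

/-!
Write `|g|` for the translation length of the isometry `g`. All Nielsen transformations are
conjugate (`IsNielsenTransformation.conj`), so they have the same translation length `ℓ`. If `ℓ = 0`,
semisimplicity provides fixed points. The rest of the file treats `ℓ > 0`.

*Geometry of abelian groups.* For commuting semisimple isometries `g`, `h` the sets `Min(g)` and
`Min(h)` meet: project a point of one to the other. The quadrilateral inequality at a common point
gives `|gh|² + |gh⁻¹|² ≤ 2|g|² + 2|h|²`; applied to `gh` and `gh⁻¹` it gives the reverse inequality,
since `|g²| = 2|g|`. So `|·|²` satisfies the parallelogram law (`tl_parallelogram`) and polarizes to a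
form `⟨g, h⟩` (`tlForm`), biadditive on abelian subgroups and invariant under conjugation. The case of
equality shows that a point of `Min(g) ∩ Min(h)` lies in `Min(gh)`, hence a finitely generated abelian
group has a point `p` in all of its sets `Min(h)`. When `|h| = ‖τ h‖` for a homomorphism `τ` to a
Euclidean space with enough values, the geodesics from `p` to its translates span a flat on which
the group acts through `τ` (`IsCAT0.exists_flat`). This replaces the flat torus theorem, and needs no
properness of the action.

*Algebra of a Nielsen `ℤ⁴`.* Comparing commutation relations with the rank, the generators of a
Nielsen `ℤ⁴` are the transvections `φ : a ↦ ca`, `ψ : a ↦ ac`, `θ : d ↦ cd`, `χ : d ↦ dc` for a basis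
`a`, `c`, `d` (`IsNielsenZ4.exists_generators`). The products `φθ`, `ψχ`, `φχ⁻¹`, `θψ⁻¹` are Nielsen
transformations for other bases, which determines the products `⟨φ, θ⟩ = ⟨ψ, χ⟩ = -ℓ²/2` and
`⟨φ, χ⟩ = ⟨θ, ψ⟩ = ℓ²/2`. Moreover `γ = φψ⁻¹θχ⁻¹` is conjugation by `c`, and commutes with an
automorphism that conjugates `θ` to `φθ`; therefore `⟨γ, φ⟩ = 0`, which amounts to `⟨φ, ψ⟩ = 0`, and
likewise `⟨θ, χ⟩ = 0` (`tlForm_left_right_same`). This is the Gram matrix of the vectors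
`κ(1, 1, 0)`, `κ(-1, 1, 0)`, `κ(-1, 0, 1)`, `κ(1, 0, 1)` with `2κ² = ℓ²`. They generate the
face-centred cubic lattice, whose Voronoi cell `|yᵢ| + |yⱼ| ≤ 1` (for `κ = 1`) is the rhombic
dodecahedron.
-/

open Filter Topology

/-! ### Distance inequalities in CAT(0) spaces -/

/-- `m` divides the pair `x`, `y` in the ratio `t : 1 - t`; in a CAT(0) space with `0 ≤ t ≤ 1` this
says that `m` is the point at fraction `t` of the geodesic from `x` to `y`. -/
def DividesAt {X : Type*} [MetricSpace X] (t : ℝ) (x y m : X) : Prop :=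
  dist x m = t * dist x y ∧ dist m y = (1 - t) * dist x y

namespace DividesAt

variable {X : Type*} [MetricSpace X] {t : ℝ} {x y m : X}

theorem symm (h : DividesAt t x y m) : DividesAt (1 - t) y x m := by
  refine ⟨?_, ?_⟩
  · rw [dist_comm y m, dist_comm y x, h.2]
  · rw [dist_comm m x, dist_comm y x, h.1]; ring

theorem map {f : X → X} (hf : Isometry f) (h : DividesAt t x y m) :
    DividesAt t (f x) (f y) (f m) := by
  simpa only [DividesAt, hf.dist_eq] using h

end DividesAt

/-- Euclidean comparison triangles exist, and the distance from a vertex to a point of the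
opposite side is given by Stewart's formula. -/
theorem exists_comparison_triangle {a b c t : ℝ} (ha : 0 < a) (hb : 0 ≤ b) (hc : 0 ≤ c)
    (ht0 : 0 ≤ t) (ht1 : t ≤ 1) (h1 : a ≤ b + c) (h2 : b ≤ a + c) (h3 : c ≤ a + b) :
    ∃ p q r x : EuclideanSpace ℝ (Fin 2), dist p q = a ∧ dist p r = b ∧ dist q r = c ∧
      dist p x = t * a ∧ dist x q = a - t * a ∧
      dist x r ^ 2 = (1 - t) * b ^ 2 + t * c ^ 2 - t * (1 - t) * a ^ 2 := by
  set u : ℝ := (a ^ 2 + b ^ 2 - c ^ 2) / (2 * a) with hu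
  have hua : 2 * a * u = a ^ 2 + b ^ 2 - c ^ 2 := by rw [hu]; field_simp
  have hub : u ^ 2 ≤ b ^ 2 := by
    have h4 : (2 * a * u) ^ 2 ≤ (2 * a * b) ^ 2 := by
      rw [hua]
      apply sq_le_sq'
      · nlinarith
      · nlinarith [abs_le_abs (show a - b ≤ c by linarith) (by linarith), mul_nonneg
          (show 0 ≤ c - (a - b) by linarith) (show 0 ≤ c + (a - b) by linarith)]
    have h5 : 0 < (2 * a) ^ 2 := by positivity
    have h6 : (2 * a) ^ 2 * u ^ 2 ≤ (2 * a) ^ 2 * b ^ 2 := by nlinarith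
    exact le_of_mul_le_mul_left h6 h5
  set v : ℝ := Real.sqrt (b ^ 2 - u ^ 2) with hv
  have hv2 : v ^ 2 = b ^ 2 - u ^ 2 := Real.sq_sqrt (by linarith)
  have key : ∀ x₁ x₂ y₁ y₂ d : ℝ, 0 ≤ d → (x₁ - y₁) ^ 2 + (x₂ - y₂) ^ 2 = d ^ 2 →
      dist (!₂[x₁, x₂] : EuclideanSpace ℝ (Fin 2)) !₂[y₁, y₂] = d := by
    intro x₁ x₂ y₁ y₂ d hd h
    rw [EuclideanSpace.dist_eq, Fin.sum_univ_two]
    simp only [Real.dist_eq, sq_abs]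
    simp [h, Real.sqrt_sq hd]
  refine ⟨!₂[0, 0], !₂[a, 0], !₂[u, v], !₂[t * a, 0], ?_, ?_, ?_, ?_, ?_, ?_⟩
  · exact key _ _ _ _ _ ha.le (by ring)
  · exact key _ _ _ _ _ hb (by nlinarith)
  · exact key _ _ _ _ _ hc (by nlinarith)
  · exact key _ _ _ _ _ (by positivity) (by ring)
  · exact key _ _ _ _ _ (by nlinarith) (by ring)
  · have h0 : 0 ≤ (t * a - u) ^ 2 + (0 - v) ^ 2 := by positivity
    rw [key (t * a) 0 u v _ (Real.sqrt_nonneg _) (Real.sq_sqrt h0).symm, Real.sq_sqrt h0]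
    linear_combination hv2 - t * hua

namespace IsCAT0

variable {X : Type*} [MetricSpace X]

theorem exists_dividesAt_stewart (hX : IsCAT0 X) (x y : X) {t : ℝ} (ht0 : 0 ≤ t) (ht1 : t ≤ 1) :
    ∃ m, DividesAt t x y m ∧ ∀ z, dist z m ^ 2 ≤
      (1 - t) * dist z x ^ 2 + t * dist z y ^ 2 - t * (1 - t) * dist x y ^ 2 := by
  rcases eq_or_ne x y with rfl | hxy
  · refine ⟨x, by simp [DividesAt], fun z => ?_⟩
    simp only [dist_self]
    nlinarith
  have hd : 0 < dist x y := dist_pos.2 hxy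
  obtain ⟨c, hc⟩ := hX.exists_geodesic x y
  have hts : t * dist x y ∈ Set.Icc 0 (dist x y) := ⟨by positivity, by nlinarith⟩
  refine ⟨c (t * dist x y), ⟨?_, ?_⟩, fun z => ?_⟩
  · have h := hc.2.2 0 ⟨le_rfl, hd.le⟩ _ hts
    rw [hc.1] at h
    rw [h, zero_sub, abs_neg, abs_of_nonneg hts.1]
  · have h := hc.2.2 _ hts (dist x y) ⟨hd.le, le_rfl⟩
    rw [hc.2.1] at h
    rw [h, abs_of_nonpos (by linarith [hts.2])]
    ring
  · obtain ⟨c', hc'⟩ := hX.exists_geodesic x z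
    obtain ⟨p', q', r', x', h1, h2, h3, h4, h5, h6⟩ := exists_comparison_triangle (t := t) hd
      (dist_nonneg (x := x) (y := z)) (dist_nonneg (x := y) (y := z)) ht0 ht1
      (by rw [dist_comm y z]; exact dist_triangle x z y) (dist_triangle x y z)
      (by rw [dist_comm x y]; exact dist_triangle y x z)
    have h := hX.comparison x y z c c' hc hc' _ hts (dist x z) ⟨dist_nonneg, le_rfl⟩
      p' q' r' x' r' h1 h2 h3 h4 h5 h2 (by simp)
    rw [hc'.2.1] at h
    rw [dist_comm z x, dist_comm z y, ← h6, dist_comm z]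
    exact pow_le_pow_left₀ dist_nonneg h 2

theorem exists_dividesAt (hX : IsCAT0 X) (x y : X) {t : ℝ} (ht0 : 0 ≤ t) (ht1 : t ≤ 1) :
    ∃ m, DividesAt t x y m :=
  (hX.exists_dividesAt_stewart x y ht0 ht1).imp fun _ h => h.1

/-- Geodesics in a CAT(0) space are unique. -/
theorem dividesAt_unique (hX : IsCAT0 X) {x y m n : X} {t : ℝ} (ht0 : 0 ≤ t) (ht1 : t ≤ 1)
    (hm : DividesAt t x y m) (hn : DividesAt t x y n) : m = n := by
  obtain ⟨k, -, hk⟩ := hX.exists_dividesAt_stewart x y ht0 ht1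
  have key : ∀ z, DividesAt t x y z → z = k := by
    intro z hz
    have h := hk z
    rw [dist_comm z x, hz.1, hz.2] at h
    have h0 : dist z k ^ 2 ≤ 0 := by nlinarith
    exact dist_eq_zero.1 (pow_eq_zero_iff two_ne_zero |>.1 (le_antisymm h0 (sq_nonneg _)))
  rw [key m hm, key n hn]

/-- The inequality of Bruhat and Tits, for arbitrary points of a geodesic. -/
theorem dist_sq_le (hX : IsCAT0 X) {x y m : X} {t : ℝ} (ht0 : 0 ≤ t) (ht1 : t ≤ 1)
    (hm : DividesAt t x y m) (z : X) : dist z m ^ 2 ≤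
      (1 - t) * dist z x ^ 2 + t * dist z y ^ 2 - t * (1 - t) * dist x y ^ 2 := by
  obtain ⟨k, hk, h⟩ := hX.exists_dividesAt_stewart x y ht0 ht1
  rw [hX.dividesAt_unique ht0 ht1 hm hk]
  exact h z

theorem dist_le_of_common_vertex (hX : IsCAT0 X) {x y z m n : X} {t : ℝ} (ht0 : 0 ≤ t)
    (ht1 : t ≤ 1) (hm : DividesAt t x y m) (hn : DividesAt t x z n) :
    dist m n ≤ t * dist y z := by
  have h1 := hX.dist_sq_le ht0 ht1 hn m
  have h2 := hX.dist_sq_le ht0 ht1 hm z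
  rw [dist_comm m x, hm.1, dist_comm m z] at h1
  rw [dist_comm z x, dist_comm z y] at h2
  refine abs_le_of_sq_le_sq' ?_ (by positivity) |>.2
  nlinarith [mul_le_mul_of_nonneg_left h2 ht0]

/-- The distance between two geodesics is a convex function. -/
theorem dist_le_of_dividesAt (hX : IsCAT0 X) {x y x' y' m m' : X} {t : ℝ} (ht0 : 0 ≤ t)
    (ht1 : t ≤ 1) (hm : DividesAt t x y m) (hm' : DividesAt t x' y' m') :
    dist m m' ≤ (1 - t) * dist x x' + t * dist y y' := by
  obtain ⟨k, hk⟩ := hX.exists_dividesAt x y' ht0 ht1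
  have h1 := hX.dist_le_of_common_vertex ht0 ht1 hm hk
  have h2 := hX.dist_le_of_common_vertex (sub_nonneg.2 ht1) (by linarith) hk.symm hm'.symm
  linarith [dist_triangle m k m']

theorem quadrilateral (hX : IsCAT0 X) (x y z w : X) :
    dist x z ^ 2 + dist y w ^ 2 ≤
      dist x y ^ 2 + dist y z ^ 2 + dist z w ^ 2 + dist w x ^ 2 := by
  obtain ⟨m, hm⟩ := hX.exists_dividesAt x z (t := 1 / 2) (by norm_num) (by norm_num)
  have h1 := hX.dist_sq_le (by norm_num) (by norm_num) hm y
  have h2 := hX.dist_sq_le (by norm_num) (by norm_num) hm w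
  rw [dist_comm y x] at h1
  rw [dist_comm w z] at h2
  have h3 := pow_le_pow_left₀ dist_nonneg (dist_triangle y m w) 2
  rw [dist_comm m w] at h3
  nlinarith [sq_nonneg (dist y m - dist w m)]

end IsCAT0

/-! ### Projections to closed convex subsets -/

/-- A subset is geodesically convex if it contains, with any two points, all points that divide
them in a ratio `t : 1 - t` with `0 ≤ t ≤ 1`. -/
def GeodConvex {X : Type*} [MetricSpace X] (C : Set X) : Prop :=
  ∀ x ∈ C, ∀ y ∈ C, ∀ t : ℝ, 0 ≤ t → t ≤ 1 → ∀ m, DividesAt t x y m → m ∈ C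

theorem GeodConvex.inter {X : Type*} [MetricSpace X] {C D : Set X} (hC : GeodConvex C)
    (hD : GeodConvex D) : GeodConvex (C ∩ D) := fun x hx y hy t h0 h1 m hm =>
  ⟨hC x hx.1 y hy.1 t h0 h1 m hm, hD x hx.2 y hy.2 t h0 h1 m hm⟩

namespace IsCAT0

variable {X : Type*} [MetricSpace X] [CompleteSpace X]

theorem exists_nearest_point (hX : IsCAT0 X) {C : Set X} (hne : C.Nonempty) (hcl : IsClosed C)
    (hC : GeodConvex C) (x : X) : ∃ p ∈ C, ∀ q ∈ C, dist x p ≤ dist x q := by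
  set r := Metric.infDist x C with hr
  have hr0 : 0 ≤ r := Metric.infDist_nonneg
  have hle : ∀ q ∈ C, r ≤ dist x q := fun q hq => Metric.infDist_le_dist_of_mem hq
  have hseq : ∀ n : ℕ, ∃ q ∈ C, dist x q < r + 1 / ((n : ℝ) + 1) := fun n =>
    (Metric.infDist_lt_iff hne).1 (lt_add_of_pos_right _ Nat.one_div_pos_of_nat)
  choose q hqC hq using hseq
  -- Two points of `C` that almost realize the distance are close, as their midpoint is in `C`.
  have hclose : ∀ n m N : ℕ, N ≤ n → N ≤ m →
      dist (q n) (q m) ≤ 2 * Real.sqrt (2 * r * (1 / ((N : ℝ) + 1)) + (1 / ((N : ℝ) + 1)) ^ 2) := by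
    intro n m N hn hm
    set e : ℝ := 1 / ((N : ℝ) + 1) with he
    have he0 : 0 < e := Nat.one_div_pos_of_nat
    have hn' : dist x (q n) ≤ r + e := (hq n).le.trans (by
      have := Nat.one_div_le_one_div (α := ℝ) hn
      linarith)
    have hm' : dist x (q m) ≤ r + e := (hq m).le.trans (by
      have := Nat.one_div_le_one_div (α := ℝ) hm
      linarith)
    obtain ⟨k, hk⟩ := hX.exists_dividesAt (q n) (q m) (t := 1 / 2) (by norm_num) (by norm_num)
    have h1 := hX.dist_sq_le (by norm_num) (by norm_num) hk x
    have h2 := hle k (hC _ (hqC n) _ (hqC m) _ (by norm_num) (by norm_num) k hk)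
    have h3 := pow_le_pow_left₀ hr0 h2 2
    have h4 := pow_le_pow_left₀ dist_nonneg hn' 2
    have h5 := pow_le_pow_left₀ dist_nonneg hm' 2
    have h6 : (dist (q n) (q m) / 2) ^ 2 ≤ 2 * r * e + e ^ 2 := by nlinarith
    have h7 := Real.le_sqrt_of_sq_le h6
    linarith
  have hlim : Tendsto (fun N : ℕ =>
      2 * Real.sqrt (2 * r * (1 / ((N : ℝ) + 1)) + (1 / ((N : ℝ) + 1)) ^ 2)) atTop (𝓝 0) := by
    have h0 := tendsto_one_div_add_atTop_nhds_zero_nat (𝕜 := ℝ)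
    have h1 := ((((h0.const_mul (2 * r)).add (h0.pow 2)).sqrt).const_mul 2)
    simpa using h1
  have hcau : CauchySeq q := cauchySeq_of_le_tendsto_0 _ hclose hlim
  obtain ⟨p, hp⟩ := cauchySeq_tendsto_of_complete hcau
  refine ⟨p, hcl.mem_of_tendsto hp (Eventually.of_forall hqC), fun y hy => le_trans ?_ (hle y hy)⟩
  have h1 : Tendsto (fun n => dist x (q n)) atTop (𝓝 (dist x p)) := tendsto_const_nhds.dist hp
  have h2 : Tendsto (fun n : ℕ => r + 1 / ((n : ℝ) + 1)) atTop (𝓝 (r + 0)) :=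
    tendsto_const_nhds.add tendsto_one_div_add_atTop_nhds_zero_nat
  rw [add_zero] at h2
  exact le_of_tendsto_of_tendsto' h1 h2 fun n => (hq n).le

/-- The nearest point `p` of a closed convex set sees every other point of the set at an angle of
at least `π / 2`. -/
theorem exists_projection (hX : IsCAT0 X) {C : Set X} (hne : C.Nonempty) (hcl : IsClosed C)
    (hC : GeodConvex C) (x : X) :
    ∃ p ∈ C, ∀ q ∈ C, dist x p ^ 2 + dist p q ^ 2 ≤ dist x q ^ 2 := by
  obtain ⟨p, hp, hmin⟩ := hX.exists_nearest_point hne hcl hC x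
  refine ⟨p, hp, fun q hq => ?_⟩
  by_contra! hlt
  -- Otherwise a point of `[p, q]` close to `p` would be closer to `x` than `p`.
  set δ := dist x p ^ 2 + dist p q ^ 2 - dist x q ^ 2 with hδ
  have hδ0 : 0 < δ := by linarith
  set t := min 1 (δ / (2 * (dist p q ^ 2 + 1))) with ht
  have ht0 : 0 < t := lt_min one_pos (by positivity)
  have ht1 : t ≤ 1 := min_le_left _ _
  have ht2 : t * (2 * (dist p q ^ 2 + 1)) ≤ δ := by
    rw [← le_div_iff₀ (by positivity)]
    exact min_le_right _ _
  obtain ⟨m, hm⟩ := hX.exists_dividesAt p q ht0.le ht1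
  have h1 := hX.dist_sq_le ht0.le ht1 hm x
  have h2 := pow_le_pow_left₀ dist_nonneg (hmin m (hC p hp q hq t ht0.le ht1 m hm)) 2
  have h3 : t * (dist x p ^ 2 - dist x q ^ 2 + (1 - t) * dist p q ^ 2) ≤ 0 := by nlinarith
  have h4 : dist x p ^ 2 - dist x q ^ 2 + (1 - t) * dist p q ^ 2 ≤ 0 :=
    nonpos_of_mul_nonpos_right h3 ht0
  nlinarith [sq_nonneg (dist p q)]

end IsCAT0

/-! ### Translation lengths of commuting semisimple isometries -/

theorem translationLength_nonneg {X : Type*} [MetricSpace X] (f : X → X) :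
    0 ≤ translationLength f := Real.iInf_nonneg fun _ => dist_nonneg

theorem translationLength_le {X : Type*} [MetricSpace X] (f : X → X) (x : X) :
    translationLength f ≤ dist x (f x) :=
  ciInf_le ⟨0, by rintro _ ⟨y, rfl⟩; exact dist_nonneg⟩ x

theorem mem_minSet_iff_le {X : Type*} [MetricSpace X] {f : X → X} {x : X} :
    x ∈ minSet f ↔ dist x (f x) ≤ translationLength f :=
  ⟨fun h => h.le, fun h => le_antisymm h (translationLength_le f x)⟩

theorem isClosed_minSet {X : Type*} [MetricSpace X] {f : X → X} (hf : Isometry f) :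
    IsClosed (minSet f) :=
  isClosed_eq (continuous_id.dist hf.continuous) continuous_const

theorem IsCAT0.geodConvex_minSet {X : Type*} [MetricSpace X] (hX : IsCAT0 X) {f : X → X}
    (hf : Isometry f) : GeodConvex (minSet f) := by
  intro x hx y hy t h0 h1 m hm
  rw [mem_minSet_iff_le] at hx hy ⊢
  have h := hX.dist_le_of_dividesAt h0 h1 hm (hm.map hf)
  nlinarith

/-- The translation length of the isometry by which `g` acts on `X`. -/
noncomputable def tl {G : Type*} (X : Type*) [MetricSpace X] [SMul G X] (g : G) : ℝ :=
  translationLength (fun x : X => g • x)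

section Action

variable {X : Type*} [MetricSpace X] {G : Type*} [Group G] [MulAction G X]

theorem tl_nonneg (g : G) : 0 ≤ tl X g := translationLength_nonneg _

theorem tl_le (g : G) (x : X) : tl X g ≤ dist x (g • x) :=
  translationLength_le (fun x : X => g • x) x

theorem tl_conj (hiso : ∀ g : G, Isometry (fun x : X => g • x)) (k h : G) :
    tl X (k * h * k⁻¹) = tl X h := by
  refine ((MulAction.toPerm k : Equiv.Perm X).iInf_congr fun x => ?_).symm
  simp only [MulAction.toPerm_apply, mul_smul, inv_smul_smul]
  exact (hiso k).dist_eq _ _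

theorem tl_inv (hiso : ∀ g : G, Isometry (fun x : X => g • x)) (h : G) :
    tl X h⁻¹ = tl X h := by
  refine iInf_congr fun x => ?_
  rw [← (hiso h).dist_eq, smul_inv_smul, dist_comm]

theorem mem_minSet_inv (hiso : ∀ g : G, Isometry (fun x : X => g • x)) {h : G} {p : X}
    (hp : p ∈ minSet (fun x : X => h • x)) : p ∈ minSet (fun x : X => h⁻¹ • x) := by
  rw [mem_minSet_iff_le] at hp ⊢
  refine le_trans (le_of_eq ?_) (hp.trans (tl_inv hiso h).ge)
  rw [← (hiso h).dist_eq, smul_inv_smul, dist_comm]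

theorem smul_mem_minSet (hiso : ∀ g : G, Isometry (fun x : X => g • x)) {g h : G}
    (hgh : Commute g h) {p : X} (hp : p ∈ minSet (fun x : X => h • x)) :
    g • p ∈ minSet (fun x : X => h • x) := by
  change dist (g • p) (h • g • p) = _
  rw [← mul_smul, ← hgh.eq, mul_smul, (hiso g).dist_eq]
  exact hp

theorem tl_sq (hX : IsCAT0 X) (hiso : ∀ g : G, Isometry (fun x : X => g • x)) {g : G}
    (hne : (minSet (fun x : X => g • x)).Nonempty) : tl X (g * g) = 2 * tl X g := by
  have : Nonempty X := ⟨hne.some⟩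
  apply le_antisymm
  · obtain ⟨p, hp⟩ := hne
    have h1 := tl_le (g * g) p
    have h2 := dist_triangle p (g • p) ((g * g) • p)
    rw [mul_smul, (hiso g).dist_eq] at h2
    have h3 : dist p (g • p) = tl X g := hp
    rw [mul_smul] at h1
    linarith
  · refine le_ciInf fun x => ?_
    -- The midpoint of `[x, g x]` is mapped to the midpoint of `[g x, g² x]`.
    obtain ⟨m, hm⟩ := hX.exists_dividesAt x (g • x) (t := 1 / 2) (by norm_num) (by norm_num)
    have hm' := hm.map (hiso g)
    have h := hX.dist_le_of_common_vertex (t := 1 - 1 / 2) (by norm_num) (by norm_num) hm.symm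
      (n := g • m) (z := g • g • x) (by
        have := hm'
        norm_num [DividesAt] at this ⊢
        exact this)
    have h1 := tl_le g m
    change 2 * tl X g ≤ dist x ((g * g) • x)
    rw [mul_smul]
    linarith

/-- The projection of a point of `Min(h)` to an `h`-invariant closed convex set is again in
`Min(h)`. -/
theorem minSet_inter_nonempty [CompleteSpace X] (hX : IsCAT0 X)
    (hiso : ∀ g : G, Isometry (fun x : X => g • x)) {h : G}
    (hne : (minSet (fun x : X => h • x)).Nonempty) {C : Set X} (hCne : C.Nonempty)
    (hcl : IsClosed C) (hC : GeodConvex C) (hinv : ∀ x ∈ C, h • x ∈ C)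
    (hinv' : ∀ x ∈ C, h⁻¹ • x ∈ C) : (C ∩ minSet (fun x : X => h • x)).Nonempty := by
  obtain ⟨x, hx⟩ := hne
  obtain ⟨p, hp, hpr⟩ := hX.exists_projection hCne hcl hC x
  refine ⟨p, hp, mem_minSet_iff_le.2 (le_trans ?_ (mem_minSet_iff_le.1 hx))⟩
  have h1 := hpr (h • p) (hinv p hp)
  have h2 := hpr (h⁻¹ • p) (hinv' p hp)
  have h3 : dist p (h⁻¹ • p) = dist p (h • p) := by
    rw [← (hiso h).dist_eq, smul_inv_smul, dist_comm]
  have h4 : dist x (h⁻¹ • p) = dist p (h • x) := by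
    rw [← (hiso h).dist_eq, smul_inv_smul, dist_comm]
  have h5 : dist (h • x) (h • p) = dist x p := (hiso h).dist_eq _ _
  rw [h3, h4] at h2
  have h6 := hX.quadrilateral x (h • x) (h • p) p
  rw [h5, dist_comm (h • p) p, dist_comm (h • x) p, dist_comm p x] at h6
  exact abs_le_of_sq_le_sq' (by linarith) dist_nonneg |>.2

theorem tl_mul_sq_add_le (hX : IsCAT0 X) (hiso : ∀ g : G, Isometry (fun x : X => g • x)) {g h : G}
    (hgh : Commute g h) {p : X} (hg : p ∈ minSet (fun x : X => g • x))
    (hh : p ∈ minSet (fun x : X => h • x)) :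
    dist p ((g * h) • p) ^ 2 + tl X (g * h⁻¹) ^ 2 ≤ 2 * tl X g ^ 2 + 2 * tl X h ^ 2 := by
  have h1 := hX.quadrilateral p (g • p) ((g * h) • p) (h • p)
  have hg' : dist p (g • p) = tl X g := hg
  have hh' : dist p (h • p) = tl X h := hh
  have h2 : dist (g • p) ((g * h) • p) = tl X h := by rw [mul_smul, (hiso g).dist_eq, hh']
  have h3 : dist ((g * h) • p) (h • p) = tl X g := by
    rw [hgh.eq, mul_smul, (hiso h).dist_eq, dist_comm, hg']
  have h4 : dist (g • p) (h • p) = dist p ((g * h⁻¹) • p) := by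
    rw [← (hiso h).dist_eq p, ← mul_smul, hgh.inv_right.eq, ← mul_assoc, mul_inv_cancel, one_mul,
      dist_comm]
  have h5 := pow_le_pow_left₀ (tl_nonneg _) (tl_le (g * h⁻¹) p) 2
  rw [hg', h2, h3, dist_comm (h • p) p, hh', h4] at h1
  linarith

variable [CompleteSpace X]

theorem minSet_inter_minSet_nonempty (hX : IsCAT0 X)
    (hiso : ∀ g : G, Isometry (fun x : X => g • x))
    (hne : ∀ g : G, (minSet (fun x : X => g • x)).Nonempty) {g h : G} (hgh : Commute g h) :
    (minSet (fun x : X => g • x) ∩ minSet (fun x : X => h • x)).Nonempty :=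
  minSet_inter_nonempty hX hiso (hne h) (hne g) (isClosed_minSet (hiso g))
    (hX.geodConvex_minSet (hiso g)) (fun _ hx => smul_mem_minSet hiso hgh.symm hx)
    (fun _ hx => smul_mem_minSet hiso hgh.symm.inv_left hx)

theorem two_mul_tl_sq_add_le (hX : IsCAT0 X) (hiso : ∀ g : G, Isometry (fun x : X => g • x))
    (hne : ∀ g : G, (minSet (fun x : X => g • x)).Nonempty) {g h : G} (hgh : Commute g h) :
    2 * tl X g ^ 2 + 2 * tl X h ^ 2 ≤ tl X (g * h) ^ 2 + tl X (g * h⁻¹) ^ 2 := by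
  have hc : Commute (g * h) (g * h⁻¹) :=
    ((Commute.refl g).mul_right hgh.inv_right).mul_left
      (hgh.symm.mul_right (Commute.refl h).inv_right)
  obtain ⟨p, h1, h2⟩ := minSet_inter_minSet_nonempty hX hiso hne hc
  have h3 := tl_mul_sq_add_le hX hiso hc h1 h2
  have h4 : g * h * (g * h⁻¹) = g * g := by
    rw [hgh.inv_right.eq]
    group
  have h5 : g * h * (g * h⁻¹)⁻¹ = h * h := by
    rw [hgh.inv_right.eq, hgh.eq]
    group
  have h6 := pow_le_pow_left₀ (tl_nonneg _) (tl_le (g * h * (g * h⁻¹)) p) 2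
  rw [h4, tl_sq hX hiso (hne g)] at h6
  rw [h4, h5, tl_sq hX hiso (hne h)] at h3
  nlinarith

/-- The parallelogram law for the translation lengths of commuting isometries: one inequality is
the quadrilateral inequality, the other one follows by applying the first to `g * h` and
`g * h⁻¹`. -/
theorem tl_parallelogram (hX : IsCAT0 X) (hiso : ∀ g : G, Isometry (fun x : X => g • x))
    (hne : ∀ g : G, (minSet (fun x : X => g • x)).Nonempty) {g h : G} (hgh : Commute g h) :
    tl X (g * h) ^ 2 + tl X (g * h⁻¹) ^ 2 = 2 * tl X g ^ 2 + 2 * tl X h ^ 2 := by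
  obtain ⟨p, h1, h2⟩ := minSet_inter_minSet_nonempty hX hiso hne hgh
  have h3 := tl_mul_sq_add_le hX hiso hgh h1 h2
  have h4 := two_mul_tl_sq_add_le hX hiso hne hgh
  have h5 := pow_le_pow_left₀ (tl_nonneg _) (tl_le (g * h) p) 2
  linarith

theorem mem_minSet_mul (hX : IsCAT0 X) (hiso : ∀ g : G, Isometry (fun x : X => g • x))
    (hne : ∀ g : G, (minSet (fun x : X => g • x)).Nonempty) {g h : G} (hgh : Commute g h) {p : X}
    (hg : p ∈ minSet (fun x : X => g • x)) (hh : p ∈ minSet (fun x : X => h • x)) :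
    p ∈ minSet (fun x : X => (g * h) • x) := by
  have h3 := tl_mul_sq_add_le hX hiso hgh hg hh
  have h4 := two_mul_tl_sq_add_le hX hiso hne hgh
  refine mem_minSet_iff_le.2 (abs_le_of_sq_le_sq' (a := dist p ((g * h) • p)) ?_
    (tl_nonneg (g * h))).2
  change _ ≤ tl X (g * h) ^ 2
  linarith

/-- A finitely generated abelian group of semisimple isometries has a point in the intersection of
all the sets `Min(h)`. -/
theorem exists_mem_minSet_closure (hX : IsCAT0 X) (hiso : ∀ g : G, Isometry (fun x : X => g • x))
    (hne : ∀ g : G, (minSet (fun x : X => g • x)).Nonempty) {S : Set G} (hfin : S.Finite)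
    (hcomm : ∀ g ∈ Subgroup.closure S, ∀ h ∈ Subgroup.closure S, Commute g h) :
    ∃ p : X, ∀ h ∈ Subgroup.closure S, p ∈ minSet (fun x : X => h • x) := by
  have hS : ∀ g ∈ S, ∀ h ∈ S, Commute g h := fun g hg h hh =>
    hcomm g (Subgroup.subset_closure hg) h (Subgroup.subset_closure hh)
  have key : ∀ T : Set G, T.Finite → T ⊆ S →
      (⋂ g ∈ T, minSet (fun x : X => g • x)).Nonempty ∧
      IsClosed (⋂ g ∈ T, minSet (fun x : X => g • x)) ∧
      GeodConvex (⋂ g ∈ T, minSet (fun x : X => g • x)) := by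
    intro T hT
    induction T, hT using Set.Finite.induction_on with
    | empty =>
      intro _
      simp only [Set.mem_empty_iff_false, Set.iInter_of_empty, Set.iInter_univ]
      exact ⟨⟨(hne 1).some, trivial⟩, isClosed_univ, fun _ _ _ _ _ _ _ _ _ => trivial⟩
    | @insert a T _ _ ih =>
      intro hsub
      obtain ⟨h1, h2, h3⟩ := ih fun x hx => hsub (Set.mem_insert_of_mem _ hx)
      have ha : a ∈ S := hsub (Set.mem_insert _ _)
      rw [Set.biInter_insert, Set.inter_comm]
      refine ⟨minSet_inter_nonempty hX hiso (hne a) h1 h2 h3 ?_ ?_,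
        h2.inter (isClosed_minSet (hiso a)), h3.inter (hX.geodConvex_minSet (hiso a))⟩ <;>
      · intro x hx
        simp only [Set.mem_iInter] at hx ⊢
        intro g hg
        have hc := hS a ha g (hsub (Set.mem_insert_of_mem _ hg))
        first
        | exact smul_mem_minSet hiso hc (hx g hg)
        | exact smul_mem_minSet hiso hc.inv_left (hx g hg)
  obtain ⟨p, hp⟩ := (key S hfin subset_rfl).1
  simp only [Set.mem_iInter] at hp
  refine ⟨p, fun h hh => ?_⟩
  induction hh using Subgroup.closure_induction with
  | mem g hg => exact hp g hg
  | one =>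
    refine mem_minSet_iff_le.2 ?_
    simpa using translationLength_nonneg _
  | mul g k hg hk ih1 ih2 => exact mem_minSet_mul hX hiso hne (hcomm g hg k hk) ih1 ih2
  | inv g _ ih => exact mem_minSet_inv hiso ih

end Action

/-! ### The quadratic form of translation lengths -/

/-- The polarization of the squared translation length. -/
noncomputable def tlForm {G : Type*} [Mul G] (X : Type*) [MetricSpace X] [SMul G X] (g h : G) : ℝ :=
  (tl X (g * h) ^ 2 - tl X g ^ 2 - tl X h ^ 2) / 2

section Form

variable {X : Type*} [MetricSpace X] {G : Type*} [Group G] [MulAction G X]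

theorem tlForm_comm {g h : G} (hgh : Commute g h) : tlForm X g h = tlForm X h g := by
  rw [tlForm, tlForm, hgh.eq]
  ring

theorem tlForm_self (hX : IsCAT0 X) (hiso : ∀ g : G, Isometry (fun x : X => g • x))
    (hne : ∀ g : G, (minSet (fun x : X => g • x)).Nonempty) (g : G) :
    tlForm X g g = tl X g ^ 2 := by
  rw [tlForm, tl_sq hX hiso (hne g)]
  ring

theorem tlForm_conj (hiso : ∀ g : G, Isometry (fun x : X => g • x)) (k g h : G) :
    tlForm X (k * g * k⁻¹) (k * h * k⁻¹) = tlForm X g h := by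
  rw [tlForm, tlForm, show k * g * k⁻¹ * (k * h * k⁻¹) = k * (g * h) * k⁻¹ by group]
  simp only [tl_conj hiso]

variable [CompleteSpace X]

/-- The argument of Jordan and von Neumann. -/
theorem tlForm_mul_right (hX : IsCAT0 X) (hiso : ∀ g : G, Isometry (fun x : X => g • x))
    (hne : ∀ g : G, (minSet (fun x : X => g • x)).Nonempty) {x y z : G} (hxy : Commute x y)
    (hxz : Commute x z) (hyz : Commute y z) :
    tlForm X x (y * z) = tlForm X x y + tlForm X x z := by
  have h1 := tl_parallelogram hX hiso hne (hxz.mul_left hyz)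
  have h2 := tl_parallelogram hX hiso hne (hxy.mul_right hxz.inv_right)
  have h3 := tl_parallelogram hX hiso hne (hxy.mul_left hyz.symm)
  have h4 := tl_parallelogram hX hiso hne hyz
  have e1 : x * (y * z⁻¹) = x * y * z⁻¹ := by group
  have e2 : x * (y * z⁻¹)⁻¹ = x * z * y⁻¹ := by group
  have e3 : x * z * y = x * (y * z) := by rw [mul_assoc, hyz.eq]
  rw [mul_assoc] at h1
  rw [e1, e2] at h2
  rw [e3] at h3
  simp only [tlForm]
  linarith

theorem tlForm_mul_left (hX : IsCAT0 X) (hiso : ∀ g : G, Isometry (fun x : X => g • x))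
    (hne : ∀ g : G, (minSet (fun x : X => g • x)).Nonempty) {x y z : G} (hxy : Commute x y)
    (hxz : Commute x z) (hyz : Commute y z) :
    tlForm X (x * y) z = tlForm X x z + tlForm X y z := by
  rw [tlForm_comm (hxz.mul_left hyz), tlForm_mul_right hX hiso hne hxz.symm hyz.symm hxy,
    tlForm_comm hxz, tlForm_comm hyz]

theorem tlForm_inv_left (hX : IsCAT0 X) (hiso : ∀ g : G, Isometry (fun x : X => g • x))
    (hne : ∀ g : G, (minSet (fun x : X => g • x)).Nonempty) {x y : G} (hxy : Commute x y) :
    tlForm X x⁻¹ y = -tlForm X x y := by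
  have h1 := tlForm_mul_left hX hiso hne (Commute.refl x).inv_right hxy hxy.inv_left
  have h2 := tlForm_mul_left hX hiso hne (Commute.one_left 1) (Commute.one_left y)
    (Commute.one_left y)
  rw [mul_inv_cancel] at h1
  rw [mul_one] at h2
  linarith

theorem tlForm_inv_right (hX : IsCAT0 X) (hiso : ∀ g : G, Isometry (fun x : X => g • x))
    (hne : ∀ g : G, (minSet (fun x : X => g • x)).Nonempty) {x y : G} (hxy : Commute x y) :
    tlForm X x y⁻¹ = -tlForm X x y := by
  rw [tlForm_comm hxy.inv_right, tlForm_inv_left hX hiso hne hxy.symm, tlForm_comm hxy]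

end Form

/-! ### Flats spanned by orbits -/

/-- If `y` is the midpoint of a geodesic `[x, z]` and the distances from `q` to `x`, `y`, `z` are
those of a Euclidean configuration, then so are the distances from `q` to the points of `[x, y]`.
The upper bound is the inequality of Bruhat and Tits for `[x, y]`, the lower bound is the same
inequality for `[a, z]` and its point `y`. -/
theorem IsCAT0.dist_eq_norm_of_dividesAt {X : Type*} [MetricSpace X] (hX : IsCAT0 X) {E : Type*}
    [NormedAddCommGroup E] [InnerProductSpace ℝ E] {x y z a q : X} {V Q : E} {t : ℝ} (ht0 : 0 ≤ t)
    (ht1 : t ≤ 1) (hxy : dist x y = ‖V‖) (hyz : dist y z = ‖V‖) (hxz : dist x z = 2 * ‖V‖)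
    (ha : DividesAt t x y a) (hqx : dist q x = ‖Q‖) (hqy : dist q y = ‖Q - V‖)
    (hqz : dist q z = ‖Q - (2 : ℝ) • V‖) : dist q a = ‖Q - t • V‖ := by
  have e : ∀ r : ℝ, ‖Q - r • V‖ ^ 2 = ‖Q‖ ^ 2 - 2 * r * inner ℝ Q V + r ^ 2 * ‖V‖ ^ 2 := by
    intro r
    rw [norm_sub_sq_real, inner_smul_right, norm_smul, mul_pow, Real.norm_eq_abs, sq_abs]
    ring
  have e1 := e 1
  rw [one_smul] at e1
  have h1 := hX.dist_sq_le ht0 ht1 ha q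
  rw [hqx, hqy, hxy, e1] at h1
  have hxa : dist x a = t * ‖V‖ := by rw [ha.1, hxy]
  have hay : dist a y = (1 - t) * ‖V‖ := by rw [ha.2, hxy]
  have haz : dist a z = (2 - t) * ‖V‖ := by
    linarith [dist_triangle a y z, dist_triangle x a z]
  have h2t : 0 < 2 - t := by linarith
  have hd : DividesAt ((1 - t) / (2 - t)) a z y := by
    refine ⟨?_, ?_⟩
    · rw [hay, haz]; field_simp
    · rw [hyz, haz]; field_simp; ring
  have h2 := hX.dist_sq_le (div_nonneg (by linarith) h2t.le)
    ((div_le_one h2t).2 (by linarith)) hd q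
  rw [hqy, hqz, haz, e1, e 2] at h2
  have h3 := mul_le_mul_of_nonneg_left h2 h2t.le
  have e3 : (2 - t) * ((1 - (1 - t) / (2 - t)) * dist q a ^ 2 +
      (1 - t) / (2 - t) * (‖Q‖ ^ 2 - 2 * 2 * inner ℝ Q V + 2 ^ 2 * ‖V‖ ^ 2) -
      (1 - t) / (2 - t) * (1 - (1 - t) / (2 - t)) * ((2 - t) * ‖V‖) ^ 2) =
      dist q a ^ 2 + (1 - t) * (‖Q‖ ^ 2 - 2 * 2 * inner ℝ Q V + 2 ^ 2 * ‖V‖ ^ 2) -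
      (1 - t) * (2 - t) * ‖V‖ ^ 2 := by
    field_simp
    ring
  rw [e3] at h3
  have h4 : dist q a ^ 2 = ‖Q - t • V‖ ^ 2 := by
    rw [e t]
    apply le_antisymm <;> nlinarith
  exact (sq_eq_sq₀ dist_nonneg (norm_nonneg _)).1 h4

/-- A map that preserves distances on a dense family of points extends to an isometry. -/
theorem exists_isometry_extending {D E X : Type*} [MetricSpace E] [MetricSpace X]
    [CompleteSpace X] {j : D → E} {k : D → X} (hj : DenseRange j)
    (hjk : ∀ a b, dist (k a) (k b) = dist (j a) (j b)) :
    ∃ ι : E → X, Isometry ι ∧ ∀ a, ι (j a) = k a := by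
  choose c hc using fun e : Set.range j => e.2
  have hk' : Isometry fun e : Set.range j => k (c e) := by
    refine Isometry.of_dist_eq fun a b => ?_
    rw [hjk, hc, hc]
    rfl
  have hd : DenseRange (Subtype.val : Set.range j → E) := by
    rw [DenseRange, Subtype.range_coe]
    exact hj
  have hu : IsUniformInducing (Subtype.val : Set.range j → E) := isUniformInducing_val _
  set ι := (hu.isDenseInducing hd).extend fun e : Set.range j => k (c e) with hι
  have hval : ∀ e : Set.range j, ι e = k (c e) :=
    fun e => uniformly_extend_of_ind hu hd hk'.uniformContinuous e
  have hcont : Continuous ι :=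
    (uniformContinuous_uniformly_extend hu hd hk'.uniformContinuous).continuous
  refine ⟨ι, Isometry.of_dist_eq fun x y => ?_, fun a => ?_⟩
  · refine hd.induction_on₂ (p := fun x y => dist (ι x) (ι y) = dist x y) ?_ ?_ x y
    · exact isClosed_eq ((hcont.comp continuous_fst).dist (hcont.comp continuous_snd))
        (continuous_fst.dist continuous_snd)
    · intro a b
      rw [hval, hval]
      exact hk'.dist_eq a b
  · rw [hval ⟨j a, a, rfl⟩, ← dist_eq_zero, hjk, hc, dist_self]

/-- If the distances in an orbit are given by a homomorphism `f` to a Euclidean space, then the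
geodesics from the base point span a flat on which the group acts by the translations `f h`. -/
theorem IsCAT0.exists_flat {X : Type*} [MetricSpace X] [CompleteSpace X] (hX : IsCAT0 X)
    {K : Type*} [Group K] [MulAction K X] (hiso : ∀ g : K, Isometry (fun x : X => g • x))
    {E : Type*} [NormedAddCommGroup E] [InnerProductSpace ℝ E] (f : Additive K →+ E) (p : X)
    (hp : ∀ h : K, dist p (h • p) = ‖f (Additive.ofMul h)‖)
    (hdense : DenseRange fun a : K × ℕ => (1 / ((a.2 : ℝ) + 1)) • f (Additive.ofMul a.1)) :
    ∃ ι : E → X, Isometry ι ∧ ∀ (h : K) (x : E), h • ι x = ι (x + f (Additive.ofMul h)) := by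
  set F : K → E := fun h => f (Additive.ofMul h) with hF
  have hmul : ∀ g h, F (g * h) = F g + F h := fun g h => by simp [hF]
  have hpow : ∀ g (n : ℕ), F (g ^ n) = (n : ℝ) • F g := fun g n => by
    simp [hF, ofMul_pow, Nat.cast_smul_eq_nsmul]
  have horb : ∀ g h : K, dist (g • p) (h • p) = ‖F g - F h‖ := by
    intro g h
    rw [dist_comm, ← (hiso h⁻¹).dist_eq, inv_smul_smul, ← mul_smul, hp]
    simp only [hF, ofMul_mul, ofMul_inv, map_add, map_neg]
    rw [neg_add_eq_sub]
  have hdbl : ∀ h : K, dist (h • p) ((h * h) • p) = ‖F h‖ ∧ dist p ((h * h) • p) = 2 * ‖F h‖ := by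
    intro h
    refine ⟨by rw [mul_smul, (hiso h).dist_eq, hp], ?_⟩
    have h2 := hp (h * h)
    change _ = ‖F (h * h)‖ at h2
    rw [h2, hmul, ← two_smul ℝ, norm_smul]
    norm_num
  have hvertex : ∀ (g h : K) (t : ℝ) (m : X), 0 ≤ t → t ≤ 1 → DividesAt t p (h • p) m →
      dist (g • p) m = ‖F g - t • F h‖ := by
    intro g h t m ht0 ht1 hm
    refine hX.dist_eq_norm_of_dividesAt ht0 ht1 (hp h) (hdbl h).1 (hdbl h).2 hm ?_ (horb g h) ?_
    · rw [dist_comm, hp]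
    · rw [horb, hmul, ← two_smul ℝ]
  have hflat : ∀ (g h : K) (s t : ℝ) (l m : X), 0 ≤ s → s ≤ 1 → 0 ≤ t → t ≤ 1 →
      DividesAt s p (g • p) l → DividesAt t p (h • p) m → dist l m = ‖s • F g - t • F h‖ := by
    intro g h s t l m hs0 hs1 ht0 ht1 hl hm
    have hq : ∀ k : K, dist l (k • p) = ‖s • F g - F k‖ := fun k => by
      rw [dist_comm, hvertex k g s l hs0 hs1 hl, norm_sub_rev]
    refine hX.dist_eq_norm_of_dividesAt ht0 ht1 (hp h) (hdbl h).1 (hdbl h).2 hm ?_ (hq h) ?_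
    · rw [dist_comm, hl.1, hp, norm_smul, Real.norm_of_nonneg hs0]
    · rw [hq, hmul, ← two_smul ℝ]
  have hpos : ∀ n : ℕ, (0 : ℝ) ≤ 1 / ((n : ℝ) + 1) := fun n => by positivity
  have hle : ∀ n : ℕ, 1 / ((n : ℝ) + 1) ≤ 1 := fun n => by
    rw [div_le_one (by positivity)]
    linarith [n.cast_nonneg (α := ℝ)]
  choose k hk using fun a : K × ℕ => hX.exists_dividesAt p (a.1 • p) (hpos a.2) (hle a.2)
  obtain ⟨ι, hι, hιk⟩ := exists_isometry_extending hdense (k := k) fun a b => by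
    rw [hflat _ _ _ _ _ _ (hpos _) (hle _) (hpos _) (hle _) (hk a) (hk b), dist_eq_norm]
  refine ⟨ι, hι, fun h x => ?_⟩
  refine hdense.induction_on (p := fun x => h • ι x = ι (x + F h)) x ?_ ?_
  · exact isClosed_eq ((hiso h).continuous.comp hι.continuous)
      (hι.continuous.comp (continuous_id.add continuous_const))
  rintro ⟨g, n⟩
  have hn : ((n : ℝ) + 1) ≠ 0 := by positivity
  have hadd : (1 / ((n : ℝ) + 1)) • F g + F h = (1 / ((n : ℝ) + 1)) • F (g * h ^ (n + 1)) := by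
    rw [hmul, hpow, smul_add, smul_smul]
    push_cast
    rw [one_div_mul_cancel hn, one_smul]
  -- Both points divide `[p, g h ^ (n + 1) p]` in the same ratio.
  change h • ι ((1 / ((n : ℝ) + 1)) • F g) = ι ((1 / ((n : ℝ) + 1)) • F g + F h)
  rw [hadd, hιk (g, n), hιk (g * h ^ (n + 1), n)]
  refine hX.dividesAt_unique (hpos n) (hle n) ⟨?_, ?_⟩ (hk (g * h ^ (n + 1), n))
  · have h1 := hvertex h⁻¹ g _ _ (hpos n) (hle n) (hk (g, n))
    rw [← (hiso h).dist_eq, smul_inv_smul] at h1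
    rw [h1, hp]
    change _ = _ * ‖F (g * h ^ (n + 1))‖
    have h2 : F h⁻¹ - (1 / ((n : ℝ) + 1)) • F g =
        -((1 / ((n : ℝ) + 1)) • F (g * h ^ (n + 1))) := by
      rw [← hadd]
      simp only [hF, ofMul_inv, map_neg]
      abel
    rw [h2, norm_neg, norm_smul, Real.norm_of_nonneg (hpos n)]
  · have h1 := hvertex (h⁻¹ * (g * h ^ (n + 1))) g _ _ (hpos n) (hle n) (hk (g, n))
    rw [← (hiso h).dist_eq, ← mul_smul, mul_inv_cancel_left, dist_comm] at h1
    rw [h1, hp]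
    change _ = _ * ‖F (g * h ^ (n + 1))‖
    have h2 : F (h⁻¹ * (g * h ^ (n + 1))) - (1 / ((n : ℝ) + 1)) • F g =
        (1 - 1 / ((n : ℝ) + 1)) • F (g * h ^ (n + 1)) := by
      rw [sub_smul, one_smul, ← hadd, hmul]
      simp only [hF, ofMul_inv, map_neg]
      abel
    rw [h2, norm_smul, Real.norm_of_nonneg (sub_nonneg.2 (hle n))]

/-! ### Bases of the free group of rank three -/

section Bases

variable (b : FreeGroupBasis (Fin 3) (FreeGroup (Fin 3)))

theorem exists_basis_of_inverse (f g : Fin 3 → FreeGroup (Fin 3))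
    (h1 : ∀ i, b.lift f (g i) = b i) (h2 : ∀ i, b.lift g (f i) = b i) :
    ∃ b' : FreeGroupBasis (Fin 3) (FreeGroup (Fin 3)), ∀ i, b' i = f i := by
  refine ⟨b.map (MonoidHom.toMulEquiv (b.lift f) (b.lift g) ?_ ?_), fun i => ?_⟩
  · exact b.ext_hom _ _ fun i => by simpa using h2 i
  · exact b.ext_hom _ _ fun i => by simpa using h1 i
  · simp

theorem exists_basis_inv :
    ∃ b' : FreeGroupBasis (Fin 3) (FreeGroup (Fin 3)), ∀ i, b' i = (b i)⁻¹ :=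
  exists_basis_of_inverse b (fun i => (b i)⁻¹) (fun i => (b i)⁻¹) (by simp) (by simp)

theorem exists_basis_inv_mul {i k : Fin 3} (hik : i ≠ k) :
    ∃ b' : FreeGroupBasis (Fin 3) (FreeGroup (Fin 3)),
      b' k = (b i)⁻¹ * b k ∧ ∀ m, m ≠ k → b' m = b m := by
  obtain ⟨b', hb'⟩ := exists_basis_of_inverse b (Function.update b k ((b i)⁻¹ * b k))
    (Function.update b k (b i * b k)) (fun m => by
      by_cases hm : m = k
      · subst hm; simp [hik]
      · simp [hm]) (fun m => by
      by_cases hm : m = k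
      · subst hm; simp [hik]
      · simp [hm])
  exact ⟨b', by simp [hb'], fun m hm => by simp [hb', hm]⟩

theorem exists_basis_mul_right {i k : Fin 3} (hik : i ≠ k) :
    ∃ b' : FreeGroupBasis (Fin 3) (FreeGroup (Fin 3)),
      b' k = b k * b i ∧ ∀ m, m ≠ k → b' m = b m := by
  obtain ⟨b', hb'⟩ := exists_basis_of_inverse b (Function.update b k (b k * b i))
    (Function.update b k (b k * (b i)⁻¹)) (fun m => by
      by_cases hm : m = k
      · subst hm; simp [hik]
      · simp [hm]) (fun m => by
      by_cases hm : m = k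
      · subst hm; simp [hik]
      · simp [hm])
  exact ⟨b', by simp [hb'], fun m hm => by simp [hb', hm]⟩

theorem exists_basis_mul_inv_right {i k : Fin 3} (hik : i ≠ k) :
    ∃ b' : FreeGroupBasis (Fin 3) (FreeGroup (Fin 3)),
      b' k = b k * (b i)⁻¹ ∧ ∀ m, m ≠ k → b' m = b m := by
  obtain ⟨b', hb'⟩ := exists_basis_of_inverse b (Function.update b k (b k * (b i)⁻¹))
    (Function.update b k (b k * b i)) (fun m => by
      by_cases hm : m = k
      · subst hm; simp [hik]
      · simp [hm]) (fun m => by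
      by_cases hm : m = k
      · subst hm; simp [hik]
      · simp [hm])
  exact ⟨b', by simp [hb'], fun m hm => by simp [hb', hm]⟩

variable {b}

theorem mulAut_ext_basis {φ ψ : MulAut (FreeGroup (Fin 3))} (h : ∀ i, φ (b i) = ψ (b i)) :
    φ = ψ := by
  have h1 : (φ.toMonoidHom : FreeGroup (Fin 3) →* _) = ψ.toMonoidHom := b.ext_hom _ _ h
  exact MulEquiv.ext fun x => DFunLike.congr_fun h1 x

theorem exists_mulAut_basis (b b' : FreeGroupBasis (Fin 3) (FreeGroup (Fin 3))) :
    ∃ ψ : MulAut (FreeGroup (Fin 3)), ∀ i, ψ (b i) = b' i :=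
  ⟨b.repr.trans b'.repr.symm, fun i => by simp; rfl⟩

theorem basis_ne_one (b : FreeGroupBasis (Fin 3) (FreeGroup (Fin 3))) (i : Fin 3) : b i ≠ 1 := by
  intro h
  have h1 := congrArg b.repr h
  rw [b.repr_apply_coe, map_one] at h1
  exact FreeGroup.of_ne_one i h1

theorem basis_not_commute (b : FreeGroupBasis (Fin 3) (FreeGroup (Fin 3))) {i j : Fin 3}
    (hij : i ≠ j) : b i * b j ≠ b j * b i := by
  intro h
  have h1 := congrArg b.repr h
  simp only [map_mul, b.repr_apply_coe] at h1
  have key : ∀ i j : Fin 3, i ≠ j →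
      FreeGroup.of i * FreeGroup.of j ≠ FreeGroup.of j * FreeGroup.of i := by decide
  exact key i j hij h1

end Bases

/-! ### Nielsen transformations -/

/-- `φ` maps `b i` to `b j * b i` (for `s = true`) or to `b i * b j` (for `s = false`), and fixes
the other elements of the basis `b`. -/
def IsTransvection (b : FreeGroupBasis (Fin 3) (FreeGroup (Fin 3))) (s : Bool) (i j : Fin 3)
    (φ : MulAut (FreeGroup (Fin 3))) : Prop :=
  i ≠ j ∧ φ (b i) = (if s then b j * b i else b i * b j) ∧ ∀ k, k ≠ i → φ (b k) = b k

theorem isNielsenTransformation_iff {b : FreeGroupBasis (Fin 3) (FreeGroup (Fin 3))}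
    {φ : MulAut (FreeGroup (Fin 3))} :
    IsNielsenTransformation b φ ↔ ∃ s i j, IsTransvection b s i j φ := by
  constructor
  · rintro ⟨i, j, hij, h | h, h'⟩
    · exact ⟨true, i, j, hij, h, h'⟩
    · exact ⟨false, i, j, hij, h, h'⟩
  · rintro ⟨s, i, j, hij, h, h'⟩
    refine ⟨i, j, hij, ?_, h'⟩
    cases s
    · exact Or.inr h
    · exact Or.inl h

theorem IsTransvection.unique {b : FreeGroupBasis (Fin 3) (FreeGroup (Fin 3))} {s : Bool}
    {i j : Fin 3} {φ ψ : MulAut (FreeGroup (Fin 3))} (h : IsTransvection b s i j φ)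
    (h' : IsTransvection b s i j ψ) : φ = ψ := by
  refine mulAut_ext_basis (b := b) fun k => ?_
  by_cases hk : k = i
  · subst hk
    rw [h.2.1, h'.2.1]
  · rw [h.2.2 k hk, h'.2.2 k hk]

/-- Every Nielsen transformation is the left transvection `a₀ ↦ a₁ a₀` of a suitable basis: a
right transvection becomes a left one when all basis elements are inverted. -/
theorem IsNielsenTransformation.exists_basis {b : FreeGroupBasis (Fin 3) (FreeGroup (Fin 3))}
    {φ : MulAut (FreeGroup (Fin 3))} (h : IsNielsenTransformation b φ) :
    ∃ b' : FreeGroupBasis (Fin 3) (FreeGroup (Fin 3)), IsTransvection b' true 0 1 φ := by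
  have hleft : ∀ (c : FreeGroupBasis (Fin 3) (FreeGroup (Fin 3))) (i j : Fin 3),
      IsTransvection c true i j φ →
      ∃ b' : FreeGroupBasis (Fin 3) (FreeGroup (Fin 3)), IsTransvection b' true 0 1 φ := by
    rintro c i j ⟨hij, h1, h2⟩
    have key : ∀ i j : Fin 3, i ≠ j → ∃ σ : Equiv.Perm (Fin 3), σ 0 = i ∧ σ 1 = j := by decide
    obtain ⟨σ, hσ0, hσ1⟩ := key i j hij
    refine ⟨c.reindex σ.symm, by decide, ?_, fun k hk => ?_⟩
    · simpa [hσ0, hσ1] using h1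
    · simp only [FreeGroupBasis.reindex_apply, Equiv.symm_symm]
      exact h2 _ fun h0 => hk (σ.injective (h0.trans hσ0.symm))
  obtain ⟨s, i, j, hs⟩ := isNielsenTransformation_iff.1 h
  cases s
  · obtain ⟨c, hc⟩ := exists_basis_inv b
    obtain ⟨hij, h1, h2⟩ := hs
    refine hleft c i j ⟨hij, ?_, fun k hk => ?_⟩
    · simp only [hc, map_inv, h1]
      simp
    · rw [hc, map_inv, h2 k hk]
  · exact hleft b i j hs

/-- All Nielsen transformations are conjugate. -/
theorem IsNielsenTransformation.conj {b b' : FreeGroupBasis (Fin 3) (FreeGroup (Fin 3))}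
    {φ φ' : MulAut (FreeGroup (Fin 3))} (h : IsNielsenTransformation b φ)
    (h' : IsNielsenTransformation b' φ') :
    ∃ ψ : MulAut (FreeGroup (Fin 3)), φ' = ψ * φ * ψ⁻¹ := by
  obtain ⟨c, -, hc1, hc2⟩ := h.exists_basis
  obtain ⟨c', -, hc1', hc2'⟩ := h'.exists_basis
  obtain ⟨ψ, hψ⟩ := exists_mulAut_basis c c'
  refine ⟨ψ, eq_mul_inv_of_mul_eq (mulAut_ext_basis (b := c) fun k => ?_)⟩
  simp only [MulAut.mul_apply, hψ]
  by_cases hk : k = 0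
  · subst hk
    simp [hc1, hc1', hψ]
  · rw [hc2 k hk, hc2' k hk, hψ]

/-! ### The transvections with a common multiplier -/

section Star

variable {b : FreeGroupBasis (Fin 3) (FreeGroup (Fin 3))} {i j k : Fin 3}
  {φ ψ θ χ : MulAut (FreeGroup (Fin 3))}

theorem forall_fin_three {p : Fin 3 → Prop} (hij : i ≠ j) (hik : i ≠ k) (hjk : j ≠ k) (hi : p i)
    (hj : p j) (hk : p k) (m : Fin 3) : p m := by
  obtain rfl | rfl | rfl : m = i ∨ m = j ∨ m = k := by omega
  exacts [hi, hj, hk]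

theorem IsTransvection.inv_apply {s : Bool} (h : IsTransvection b s i j φ) :
    φ⁻¹ (b i) = (if s then (b j)⁻¹ * b i else b i * (b j)⁻¹) ∧ ∀ k, k ≠ i → φ⁻¹ (b k) = b k := by
  have h2 : ∀ k, k ≠ i → φ⁻¹ (b k) = b k := fun k hk => by
    apply φ.injective
    rw [MulAut.apply_inv_self, h.2.2 k hk]
  refine ⟨φ.injective ?_, h2⟩
  rw [MulAut.apply_inv_self]
  cases s <;> simp [h.2.1, h.2.2 j h.1.symm]

theorem isNielsenTransformation_left_mul_left (hjk : j ≠ k)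
    (hφ : IsTransvection b true i j φ) (hθ : IsTransvection b true k j θ) (hik : i ≠ k) :
    ∃ b', IsNielsenTransformation b' (φ * θ) := by
  obtain ⟨b', h1, h2⟩ := exists_basis_inv_mul b hik
  refine ⟨b', i, j, hφ.1, Or.inl ?_, ?_⟩
  · rw [h2 i hik, h2 j hjk, MulAut.mul_apply, hθ.2.2 i hik, hφ.2.1]
    rfl
  · intro m hm
    obtain rfl | rfl : m = j ∨ m = k := by have := hφ.1; omega
    · rw [h2 m hjk, MulAut.mul_apply, hθ.2.2 m hjk, hφ.2.2 m hm]
    · rw [h1, MulAut.mul_apply, map_mul, map_inv, hθ.2.2 i hik, hθ.2.1]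
      simp [hφ.2.1, hφ.2.2 j hφ.1.symm, hφ.2.2 m hm]

theorem isNielsenTransformation_right_mul_right (hjk : j ≠ k)
    (hφ : IsTransvection b false i j φ) (hθ : IsTransvection b false k j θ) (hik : i ≠ k) :
    ∃ b', IsNielsenTransformation b' (φ * θ) := by
  obtain ⟨b', h1, h2⟩ := exists_basis_mul_inv_right b hik
  refine ⟨b', i, j, hφ.1, Or.inr ?_, ?_⟩
  · rw [h2 i hik, h2 j hjk, MulAut.mul_apply, hθ.2.2 i hik, hφ.2.1]
    rfl
  · intro m hm
    obtain rfl | rfl : m = j ∨ m = k := by have := hφ.1; omega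
    · rw [h2 m hjk, MulAut.mul_apply, hθ.2.2 m hjk, hφ.2.2 m hm]
    · rw [h1, MulAut.mul_apply, map_mul, map_inv, hθ.2.2 i hik, hθ.2.1]
      simp [hφ.2.1, hφ.2.2 j hφ.1.symm, hφ.2.2 m hm]

theorem isNielsenTransformation_left_mul_right_inv (hjk : j ≠ k)
    (hφ : IsTransvection b true i j φ) (hθ : IsTransvection b false k j θ) (hik : i ≠ k) :
    ∃ b', IsNielsenTransformation b' (φ * θ⁻¹) := by
  obtain ⟨b', h1, h2⟩ := exists_basis_mul_right b hik
  obtain ⟨h3, h4⟩ := hθ.inv_apply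
  refine ⟨b', i, j, hφ.1, Or.inl ?_, ?_⟩
  · rw [h2 i hik, h2 j hjk, MulAut.mul_apply, h4 i hik, hφ.2.1]
    rfl
  · intro m hm
    obtain rfl | rfl : m = j ∨ m = k := by have := hφ.1; omega
    · rw [h2 m hjk, MulAut.mul_apply, h4 m hjk, hφ.2.2 m hm]
    · rw [h1, MulAut.mul_apply, map_mul, h4 i hik, h3]
      simp [hφ.2.1, hφ.2.2 j hφ.1.symm, hφ.2.2 m hm]

theorem IsTransvection.commute_same (hφ : IsTransvection b true i j φ)
    (hψ : IsTransvection b false i j ψ) : Commute φ ψ := by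
  refine mulAut_ext_basis (b := b) fun m => ?_
  rw [MulAut.mul_apply, MulAut.mul_apply]
  by_cases hm : m = i
  · subst hm
    simp [hφ.2.1, hψ.2.1, hφ.2.2 j hφ.1.symm, hψ.2.2 j hψ.1.symm, mul_assoc]
  · rw [hφ.2.2 m hm, hψ.2.2 m hm, hφ.2.2 m hm]

theorem IsTransvection.commute_of_ne {s s' : Bool} (hφ : IsTransvection b s i j φ)
    (hθ : IsTransvection b s' k j θ) (hik : i ≠ k) : Commute φ θ := by
  refine mulAut_ext_basis (b := b) (forall_fin_three hφ.1 hik hθ.1.symm ?_ ?_ ?_) <;>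
    rw [MulAut.mul_apply, MulAut.mul_apply]
  · rw [hθ.2.2 i hik, hφ.2.1]
    cases s <;> simp [hθ.2.2 i hik, hθ.2.2 j hθ.1.symm]
  · rw [hθ.2.2 j hθ.1.symm, hφ.2.2 j hφ.1.symm, hθ.2.2 j hθ.1.symm]
  · rw [hφ.2.2 k hik.symm, hθ.2.1]
    cases s' <;> simp [hφ.2.2 k hik.symm, hφ.2.2 j hφ.1.symm]

/-- The product of the four commuting transvections is an inner automorphism. -/
theorem mul_inv_mul_mul_inv_eq_conj (hik : i ≠ k) (hφ : IsTransvection b true i j φ)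
    (hψ : IsTransvection b false i j ψ) (hθ : IsTransvection b true k j θ)
    (hχ : IsTransvection b false k j χ) : φ * ψ⁻¹ * (θ * χ⁻¹) = MulAut.conj (b j) := by
  obtain ⟨h1, h2⟩ := hψ.inv_apply
  obtain ⟨h3, h4⟩ := hχ.inv_apply
  have hj := hφ.1.symm
  have hj' := hθ.1.symm
  refine mulAut_ext_basis (b := b) (forall_fin_three hφ.1 hik hθ.1.symm ?_ ?_ ?_) <;>
    simp [-MulAut.inv_apply, -MulAut.coe_inv, h1, h2 k hik.symm, h2 j hj, h3, h4 i hik,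
      h4 j hj', hφ.2.1, hφ.2.2 j hj, hφ.2.2 k hik.symm, hθ.2.1, hθ.2.2 i hik, hθ.2.2 j hj', mul_assoc]

/-- The transvection of `b k` is conjugated to the product of the transvections of `b i` and
`b k`, by an automorphism that commutes with the inner automorphism of `b j`. -/
theorem exists_conj_eq_mul (hik : i ≠ k) (hφ : IsTransvection b true i j φ)
    (hθ : IsTransvection b true k j θ) :
    ∃ x : MulAut (FreeGroup (Fin 3)), x * θ * x⁻¹ = φ * θ ∧
      x * MulAut.conj (b j) * x⁻¹ = MulAut.conj (b j) := by
  obtain ⟨b', h1, h2⟩ := exists_basis_inv_mul b hik.symm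
  obtain ⟨x, hx⟩ := exists_mulAut_basis b b'
  have hxj : x (b j) = b j := by rw [hx, h2 j hφ.1.symm]
  have hxk : x (b k) = b k := by rw [hx, h2 k hik.symm]
  have hxi : x (b i) = (b k)⁻¹ * b i := by rw [hx, h1]
  refine ⟨x, mul_inv_eq_of_eq_mul (mulAut_ext_basis (b := b)
    (forall_fin_three hφ.1 hik hθ.1.symm ?_ ?_ ?_)), mul_inv_eq_of_eq_mul (MulEquiv.ext fun y => ?_)⟩
  · simp [hxi, hθ.2.1, hθ.2.2 i hik, hφ.2.1, hφ.2.2 k hik.symm, hφ.2.2 j hφ.1.symm]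
  · simp [hxj, hθ.2.2 j hθ.1.symm, hφ.2.2 j hφ.1.symm]
  · simp [hxj, hxk, hθ.2.1, hφ.2.2 k hik.symm, hφ.2.2 j hφ.1.symm]
  · simp [hxj]

end Star

/-! ### Nielsen subgroups isomorphic to the free abelian group of rank four -/

section Classification

variable {b : FreeGroupBasis (Fin 3) (FreeGroup (Fin 3))} {i j i' j' : Fin 3} {s s' : Bool}
  {φ ψ : MulAut (FreeGroup (Fin 3))}

theorem IsTransvection.ne_of_commute (hφ : IsTransvection b s i j φ)
    (hψ : IsTransvection b s' i' j' ψ) (hc : Commute φ ψ) : j ≠ i' := by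
  rintro rfl
  have h1 : ψ (φ (b i)) = φ (b i) := by
    rw [← MulAut.mul_apply, ← hc.eq, MulAut.mul_apply, hψ.2.2 i hφ.1]
  have h2 : ψ (b j) = b j := by
    rw [hφ.2.1] at h1
    cases s <;> simpa [hψ.2.2 i hφ.1] using h1
  rw [hψ.2.1] at h2
  apply basis_ne_one b j'
  cases s' <;> simpa using h2

theorem IsTransvection.side_ne_of_commute (hφ : IsTransvection b s i j φ)
    (hψ : IsTransvection b s' i j' ψ) (hc : Commute φ ψ) (hjj : j ≠ j') : s ≠ s' := by
  rintro rfl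
  have h1 : φ (ψ (b i)) = ψ (φ (b i)) := by
    rw [← MulAut.mul_apply, hc.eq, MulAut.mul_apply]
  apply basis_not_commute b hjj
  rw [hψ.2.1, hφ.2.1] at h1
  cases s <;> simp [hφ.2.1, hψ.2.1, hφ.2.2 j' hψ.1.symm, hψ.2.2 j hφ.1.symm, mul_assoc] at h1
  · exact h1
  · rw [← mul_assoc, ← mul_assoc, mul_left_inj] at h1
    exact h1.symm

/-- Two commuting transvections with different multipliers multiply the same basis element, from
different sides. -/
theorem IsTransvection.eq_and_ne_of_commute (hφ : IsTransvection b s i j φ)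
    (hψ : IsTransvection b s' i' j' ψ) (hc : Commute φ ψ) (hjj : j ≠ j') : i = i' ∧ s ≠ s' := by
  have h1 := hφ.ne_of_commute hψ hc
  have h2 := hψ.ne_of_commute hφ hc.symm
  have h3 : i = i' := by
    have := hφ.1
    have := hψ.1
    omega
  subst h3
  exact ⟨rfl, hφ.side_ne_of_commute hψ hc hjj⟩

theorem four_le_ncard_of_closure_mulEquiv {G : Type*} [Group G] {S : Set G} (hfin : S.Finite)
    (e : Subgroup.closure S ≃* Multiplicative (Fin 4 → ℤ)) : 4 ≤ S.ncard := by
  classical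
  have := hfin.fintype
  set f : S → (Fin 4 → ℤ) := fun x => (e ⟨x, Subgroup.subset_closure x.2⟩).toAdd with hf
  have hspan : Submodule.span ℤ (Set.range f) = ⊤ := by
    rw [eq_top_iff]
    rintro v -
    obtain ⟨⟨x, hx⟩, hxv⟩ := e.surjective (Multiplicative.ofAdd v)
    have key : (e ⟨x, hx⟩).toAdd ∈ Submodule.span ℤ (Set.range f) := by
      clear hxv
      induction hx using Subgroup.closure_induction with
      | mem y hy => exact Submodule.subset_span ⟨⟨y, hy⟩, rfl⟩
      | one =>
        have : e ⟨1, one_mem _⟩ = 1 := map_one e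
        rw [this]
        exact zero_mem _
      | mul y z hy hz h1 h2 =>
        have : e ⟨y * z, mul_mem hy hz⟩ = e ⟨y, hy⟩ * e ⟨z, hz⟩ := by rw [← map_mul]; rfl
        rw [this]
        exact add_mem h1 h2
      | inv y hy h1 =>
        have : e ⟨y⁻¹, inv_mem hy⟩ = (e ⟨y, hy⟩)⁻¹ := by rw [← map_inv]; rfl
        rw [this]
        exact neg_mem h1
    rw [hxv] at key
    exact key
  have h1 := finrank_range_le_card (R := ℤ) f
  rw [Set.finrank, hspan, finrank_top] at h1
  rw [Set.ncard_eq_toFinset_card', Set.toFinset_card]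
  simpa using h1

/-- The generators of a Nielsen `ℤ⁴` are the four transvections with a common multiplier. -/
theorem IsNielsenZ4.exists_generators {H : Subgroup (MulAut (FreeGroup (Fin 3)))}
    (hH : IsNielsenZ4 H) : ∃ (b : FreeGroupBasis (Fin 3) (FreeGroup (Fin 3))) (i j k : Fin 3)
      (φ ψ θ χ : MulAut (FreeGroup (Fin 3))), i ≠ k ∧
      IsTransvection b true i j φ ∧ IsTransvection b false i j ψ ∧
      IsTransvection b true k j θ ∧ IsTransvection b false k j χ ∧
      H = Subgroup.closure {φ, ψ, θ, χ} := by
  classical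
  obtain ⟨⟨b, S, hS, rfl⟩, ⟨e⟩⟩ := hH
  have hcomm : ∀ φ ∈ S, ∀ ψ ∈ S, Commute φ ψ := by
    intro φ hφ ψ hψ
    have h1 : (⟨φ, Subgroup.subset_closure hφ⟩ : Subgroup.closure S) *
        ⟨ψ, Subgroup.subset_closure hψ⟩ = ⟨ψ, Subgroup.subset_closure hψ⟩ *
        ⟨φ, Subgroup.subset_closure hφ⟩ := e.injective (by rw [map_mul, map_mul, mul_comm])
    exact congrArg Subtype.val h1
  choose s i j h using fun φ : S => isNielsenTransformation_iff.1 (hS φ φ.2)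
  have hinj : Function.Injective fun φ : S => (s φ, i φ, j φ) := by
    intro φ ψ hφψ
    simp only [Prod.mk.injEq] at hφψ
    have hψ := h ψ
    rw [← hφψ.1, ← hφψ.2.1, ← hφψ.2.2] at hψ
    exact Subtype.ext ((h φ).unique hψ)
  have hfinS : Finite S := Finite.of_injective _ hinj
  have hfin : S.Finite := hfinS
  have := hfin.fintype
  have hcard := four_le_ncard_of_closure_mulEquiv hfin e
  -- If two multipliers occurred, then there would be no room for a third generator.
  have hj : ∀ φ ψ : S, j φ = j ψ := by
    by_contra! hne
    obtain ⟨φ, ψ, hne⟩ := hne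
    obtain ⟨hi, hs⟩ := (h φ).eq_and_ne_of_commute (h ψ) (hcomm _ φ.2 _ ψ.2) hne
    have hsub : S ⊆ {φ.1, ψ.1} := by
      intro θ hθ
      have key : (⟨θ, hθ⟩ : S) = φ ∨ (⟨θ, hθ⟩ : S) = ψ := by
        generalize (⟨θ, hθ⟩ : S) = θ
        have hc1 := (h φ).eq_and_ne_of_commute (h θ) (hcomm _ φ.2 _ θ.2)
        have hc2 := (h ψ).eq_and_ne_of_commute (h θ) (hcomm _ ψ.2 _ θ.2)
        by_cases h1 : j φ = j θ
        · obtain ⟨h2, h3⟩ := hc2 fun h4 => hne (h1.trans h4.symm)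
          refine Or.inl (hinj ?_)
          simp only [Prod.mk.injEq]
          refine ⟨?_, by rw [← h2, hi], h1.symm⟩
          revert hs h3
          cases s φ <;> cases s ψ <;> cases s θ <;> simp
        · obtain ⟨h2, h3⟩ := hc1 h1
          by_cases h4 : j ψ = j θ
          · refine Or.inr (hinj ?_)
            simp only [Prod.mk.injEq]
            refine ⟨?_, by rw [← h2, hi], h4.symm⟩
            revert hs h3
            cases s φ <;> cases s ψ <;> cases s θ <;> simp
          · exfalso
            have h5 := (hc2 h4).2
            revert hs h3 h5
            cases s φ <;> cases s ψ <;> cases s θ <;> simp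
      rcases key with h1 | h1
      · exact Or.inl (congrArg Subtype.val h1)
      · exact Or.inr (congrArg Subtype.val h1)
    have h1 := Set.ncard_le_ncard hsub (by simp)
    have h2 := Set.ncard_insert_le φ.1 {ψ.1}
    rw [Set.ncard_singleton] at h2
    omega
  have hne : S.Nonempty := by
    rw [← Set.ncard_pos hfin]
    omega
  obtain ⟨φ₀, hφ₀⟩ := hne
  set j₀ := j ⟨φ₀, hφ₀⟩ with hj₀
  have hj' : ∀ φ : S, j φ = j₀ := fun φ => hj _ _
  have himg : (Finset.univ.image fun φ : S => (s φ, i φ)) =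
      Finset.univ ×ˢ Finset.univ.erase j₀ := by
    apply Finset.eq_of_subset_of_card_le
    · intro x hx
      obtain ⟨φ, -, rfl⟩ := Finset.mem_image.1 hx
      have := (h φ).1
      rw [hj' φ] at this
      simpa using this
    · rw [Finset.card_image_of_injective _ fun φ ψ hφψ => hinj (by
        simp only [Prod.mk.injEq] at hφψ ⊢
        exact ⟨hφψ.1, hφψ.2, hj _ _⟩)]
      rw [Set.ncard_eq_toFinset_card', Set.toFinset_card] at hcard
      simpa [Finset.card_erase_of_mem] using hcard
  have hex : ∀ (t : Bool) (m : Fin 3), m ≠ j₀ → ∃ φ ∈ S, IsTransvection b t m j₀ φ := by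
    intro t m hm
    have : (t, m) ∈ (Finset.univ.image fun φ : S => (s φ, i φ)) := by
      rw [himg]
      simpa using hm
    obtain ⟨φ, -, hφ⟩ := Finset.mem_image.1 this
    simp only [Prod.mk.injEq] at hφ
    refine ⟨φ, φ.2, ?_⟩
    have h1 := h φ
    rwa [hφ.1, hφ.2, hj' φ] at h1
  obtain ⟨m, n, hmj, hnj, hmn⟩ : ∃ m n : Fin 3, m ≠ j₀ ∧ n ≠ j₀ ∧ m ≠ n := by
    generalize j₀ = j₀
    revert j₀
    decide
  obtain ⟨φ, hφS, hφ⟩ := hex true m hmj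
  obtain ⟨ψ, hψS, hψ⟩ := hex false m hmj
  obtain ⟨θ, hθS, hθ⟩ := hex true n hnj
  obtain ⟨χ, hχS, hχ⟩ := hex false n hnj
  refine ⟨b, m, j₀, n, φ, ψ, θ, χ, hmn, hφ, hψ, hθ, hχ, congrArg _ (Set.Subset.antisymm ?_ ?_)⟩
  · intro x hx
    have h1 := h ⟨x, hx⟩
    rw [hj'] at h1
    obtain h2 | h2 : i ⟨x, hx⟩ = m ∨ i ⟨x, hx⟩ = n := by
      have := h1.1
      omega
    · rw [h2] at h1
      cases h3 : s ⟨x, hx⟩ <;> rw [h3] at h1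
      · exact Or.inr (Or.inl (h1.unique hψ))
      · exact Or.inl (h1.unique hφ)
    · rw [h2] at h1
      cases h3 : s ⟨x, hx⟩ <;> rw [h3] at h1
      · exact Or.inr (Or.inr (Or.inr (h1.unique hχ)))
      · exact Or.inr (Or.inr (Or.inl (h1.unique hθ)))
  · rintro x (rfl | rfl | rfl | rfl) <;> assumption

end Classification

/-! ### The Voronoi cell of the face-centred cubic lattice -/

/-- The face-centred cubic lattice `D₃` (integer vectors with even coordinate sum), scaled
by `κ`. -/
def scaledFcc (κ : ℝ) : Set (EuclideanSpace ℝ (Fin 3)) :=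
  {x | ∃ a : Fin 3 → ℤ, Even (a 0 + a 1 + a 2) ∧ ∀ i, x i = κ * a i}

theorem convex_abs_coord_add_abs_coord_le :
    Convex ℝ {y : EuclideanSpace ℝ (Fin 3) | ∀ i j, i ≠ j → |y i| + |y j| ≤ 1} := by
  intro x hx y hy a b ha hb hab i j hij
  simp only [PiLp.add_apply, PiLp.smul_apply, smul_eq_mul]
  have h1 := abs_add_le (a * x i) (b * y i)
  have h2 := abs_add_le (a * x j) (b * y j)
  rw [abs_mul, abs_mul, abs_of_nonneg ha, abs_of_nonneg hb] at h1 h2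
  nlinarith [hx i j hij, hy i j hij]

/-- The cube is the convex hull of its vertices. -/
theorem mem_convexHull_of_abs_le_half {y : EuclideanSpace ℝ (Fin 3)} (hy : ∀ i, |y i| ≤ 1 / 2) :
    y ∈ convexHull ℝ {x : EuclideanSpace ℝ (Fin 3) | ∀ i, x i = 1 / 2 ∨ x i = -1 / 2} := by
  have h1 : (y : Fin 3 → ℝ) ∈ convexHull ℝ
      (Set.univ.pi fun _ : Fin 3 => ({1 / 2, -1 / 2} : Set ℝ)) := by
    rw [convexHull_pi]
    intro i _
    rw [convexHull_pair, segment_symm, segment_eq_Icc (by norm_num)]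
    have := abs_le.1 (hy i)
    constructor <;> linarith
  have h2 := Set.mem_image_of_mem
    ((EuclideanSpace.equiv (Fin 3) ℝ).symm.toLinearEquiv.toLinearMap) h1
  rw [LinearMap.image_convexHull] at h2
  refine convexHull_mono ?_ h2
  rintro _ ⟨x, hx, rfl⟩ i
  exact hx i trivial

/-- Outside of the cube, the points of the polyhedron `|yᵢ| + |yⱼ| ≤ 1` lie in the pyramids over
the faces of the cube with apices `±eᵢ`. -/
theorem mem_stdRhombicDodecahedron_iff {y : EuclideanSpace ℝ (Fin 3)} :
    y ∈ stdRhombicDodecahedron ↔ ∀ i j, i ≠ j → |y i| + |y j| ≤ 1 := by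
  constructor
  · intro hy
    refine convexHull_min ?_ convex_abs_coord_add_abs_coord_le hy
    rintro x (⟨k, rfl | rfl⟩ | hx) i j hij
    · by_cases h1 : i = k <;> by_cases h2 : j = k <;> simp_all
    · by_cases h1 : i = k <;> by_cases h2 : j = k <;> simp_all
    · rcases hx i with h1 | h1 <;> rcases hx j with h2 | h2 <;> rw [h1, h2] <;> norm_num
  · intro h
    have hcube : ∀ z : EuclideanSpace ℝ (Fin 3), (∀ i, |z i| ≤ 1 / 2) →
        z ∈ stdRhombicDodecahedron := fun z hz =>
      convexHull_mono Set.subset_union_right (mem_convexHull_of_abs_le_half hz)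
    by_cases hc : ∀ i, |y i| ≤ 1 / 2
    · exact hcube y hc
    push Not at hc
    obtain ⟨i, hi⟩ := hc
    have hapex : ∃ s : ℝ, |s| = 1 ∧ y i = s * |y i| ∧
        EuclideanSpace.single i s ∈ stdRhombicDodecahedron := by
      rcases le_total 0 (y i) with h0 | h0
      · exact ⟨1, by simp, by rw [abs_of_nonneg h0, one_mul],
          subset_convexHull _ _ (Or.inl ⟨i, Or.inl rfl⟩)⟩
      · exact ⟨-1, by simp, by rw [abs_of_nonpos h0]; ring,
          subset_convexHull _ _ (Or.inl ⟨i, Or.inr rfl⟩)⟩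
    obtain ⟨s, hs, hys, hsm⟩ := hapex
    set r := |y i| with hr
    have hr1 : r ≤ 1 := by
      obtain ⟨j, hj⟩ := exists_ne i
      linarith [h i j hj.symm, abs_nonneg (y j)]
    rcases eq_or_lt_of_le hr1 with h1 | h1
    · have : y = EuclideanSpace.single i s := by
        ext j
        by_cases hj : j = i
        · subst hj
          rw [hys, h1]
          simp
        · have := h j i hj
          have h0 : |y j| = 0 := le_antisymm (by linarith) (abs_nonneg _)
          simp [hj, abs_eq_zero.1 h0]
      rw [this]
      exact hsm
    · set z : EuclideanSpace ℝ (Fin 3) := WithLp.toLp 2 fun j =>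
        if j = i then s / 2 else y j / (2 * (1 - r)) with hz
      have hzc : z ∈ stdRhombicDodecahedron := by
        refine hcube z fun j => ?_
        by_cases hj : j = i
        · simp [hz, hj, abs_div, hs]
        · have := h j i hj
          simp only [hz, if_neg hj, abs_div]
          rw [abs_of_pos (by linarith : 0 < 2 * (1 - r)), div_le_iff₀ (by linarith)]
          linarith
      have hcomb : y = (2 * r - 1) • EuclideanSpace.single i s + (2 * (1 - r)) • z := by
        ext j
        by_cases hj : j = i
        · subst hj
          simp [hz]
          rw [hys]
          ring
        · have : (1 - r) ≠ 0 := by linarith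
          simp [hz, hj]
          field_simp
      rw [hcomb]
      exact convex_convexHull ℝ _ hsm hzc (by linarith) (by linarith) (by ring)

theorem two_mul_inner_le_of_mem_stdRhombicDodecahedron {y : EuclideanSpace ℝ (Fin 3)}
    (hy : y ∈ stdRhombicDodecahedron) {a : Fin 3 → ℤ} (ha : Even (a 0 + a 1 + a 2)) :
    2 * ∑ i, y i * (a i : ℝ) ≤ ∑ i, (a i : ℝ) ^ 2 := by
  have hconv : Convex ℝ {y : EuclideanSpace ℝ (Fin 3) |
      2 * ∑ i, y i * (a i : ℝ) ≤ ∑ i, (a i : ℝ) ^ 2} := by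
    intro x hx z hz c d hc hd hcd
    simp only [Set.mem_ofPred_eq, Fin.sum_univ_three, PiLp.add_apply, PiLp.smul_apply,
      smul_eq_mul] at hx hz ⊢
    nlinarith
  refine convexHull_min ?_ hconv hy
  have hsq : ∀ n : ℤ, |n| ≤ n ^ 2 := fun n => by
    rw [← sq_abs]
    rcases (abs_nonneg n).eq_or_lt with h | h
    · rw [← h]; norm_num
    · nlinarith
  rintro x (⟨k, hk⟩ | hx)
  · -- The vertices `±eₖ`: here the parity of the coordinate sum is needed.
    have hint : 2 * |a k| ≤ a 0 ^ 2 + a 1 ^ 2 + a 2 ^ 2 := by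
      have hpar : Even (|a 0| + |a 1| + |a 2|) := by
        simpa only [Int.even_add, even_abs] using ha
      have h0 := hsq (a 0)
      have h1 := hsq (a 1)
      have h2 := hsq (a 2)
      by_cases hlarge : 2 ≤ |a k|
      · have h3 : 2 * |a k| ≤ a k ^ 2 := by rw [← sq_abs]; nlinarith
        fin_cases k <;> simp at h3 ⊢ <;> nlinarith [sq_nonneg (a 0), sq_nonneg (a 1), sq_nonneg (a 2)]
      · have a0 := abs_nonneg (a 0)
        have a1 := abs_nonneg (a 1)
        have a2 := abs_nonneg (a 2)
        obtain ⟨m, hm⟩ := hpar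
        fin_cases k <;> simp at hlarge ⊢ <;> omega
    have hint' : 2 * |(a k : ℝ)| ≤ (a 0 : ℝ) ^ 2 + (a 1 : ℝ) ^ 2 + (a 2 : ℝ) ^ 2 := by
      exact_mod_cast hint
    have h1 := le_abs_self (a k : ℝ)
    have h2 := neg_abs_le (a k : ℝ)
    simp only [Set.mem_ofPred_eq, Fin.sum_univ_three]
    rcases hk with rfl | rfl <;> fin_cases k <;> simp at h1 h2 hint' ⊢ <;> linarith
  · have h : ∀ i, 2 * (x i * (a i : ℝ)) ≤ (a i : ℝ) ^ 2 := by
      intro i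
      have h1 : |(a i : ℝ)| ≤ (a i : ℝ) ^ 2 := by exact_mod_cast hsq (a i)
      have h2 := le_abs_self (a i : ℝ)
      have h3 := neg_abs_le (a i : ℝ)
      rcases hx i with hi | hi <;> rw [hi] <;> linarith
    rw [Set.mem_ofPred_eq, Finset.mul_sum]
    exact Finset.sum_le_sum fun i _ => h i

theorem isRhombicDodecahedron_dirichletDomain_scaledFcc {κ : ℝ} (hκ : 0 < κ)
    (o : EuclideanSpace ℝ (Fin 3)) : IsRhombicDodecahedron (dirichletDomain (scaledFcc κ) o) := by
  have hcell : ∀ y : EuclideanSpace ℝ (Fin 3), y ∈ stdRhombicDodecahedron ↔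
      ∀ a : Fin 3 → ℤ, Even (a 0 + a 1 + a 2) →
        2 * ∑ i, y i * (a i : ℝ) ≤ ∑ i, (a i : ℝ) ^ 2 := by
    intro y
    refine ⟨fun hy a ha => two_mul_inner_le_of_mem_stdRhombicDodecahedron hy ha, fun h => ?_⟩
    rw [mem_stdRhombicDodecahedron_iff]
    -- The twelve shortest lattice vectors give the faces.
    have h110 := h ![1, 1, 0] (by decide)
    have h1m0 := h ![1, -1, 0] (by decide)
    have hm10 := h ![-1, 1, 0] (by decide)
    have hmm0 := h ![-1, -1, 0] (by decide)
    have h101 := h ![1, 0, 1] (by decide)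
    have h10m := h ![1, 0, -1] (by decide)
    have hm01 := h ![-1, 0, 1] (by decide)
    have hm0m := h ![-1, 0, -1] (by decide)
    have h011 := h ![0, 1, 1] (by decide)
    have h01m := h ![0, 1, -1] (by decide)
    have h0m1 := h ![0, -1, 1] (by decide)
    have h0mm := h ![0, -1, -1] (by decide)
    simp [Fin.sum_univ_three] at h110 h1m0 hm10 hmm0 h101 h10m hm01 hm0m h011 h01m h0m1 h0mm
    intro i j hij
    rcases abs_cases (y i) with ⟨h1, -⟩ | ⟨h1, -⟩ <;>
      rcases abs_cases (y j) with ⟨h2, -⟩ | ⟨h2, -⟩ <;>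
      rw [h1, h2] <;> fin_cases i <;> fin_cases j <;> simp at hij ⊢ <;> linarith
  refine ⟨o, κ, LinearIsometryEquiv.refl ℝ _, hκ, ?_⟩
  have hdist : ∀ y : EuclideanSpace ℝ (Fin 3), (o + κ • y) ∈ dirichletDomain (scaledFcc κ) o ↔
      y ∈ stdRhombicDodecahedron := by
    intro y
    rw [hcell]
    have key : ∀ (t : EuclideanSpace ℝ (Fin 3)) (a : Fin 3 → ℤ), (∀ i, t i = κ * a i) →
        (dist (o + κ • y) o ≤ dist (o + κ • y) (o + t) ↔
          2 * ∑ i, y i * (a i : ℝ) ≤ ∑ i, (a i : ℝ) ^ 2) := by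
      intro t a hta
      rw [← sq_le_sq₀ dist_nonneg dist_nonneg, EuclideanSpace.dist_sq_eq,
        EuclideanSpace.dist_sq_eq]
      simp only [Real.dist_eq, sq_abs, Fin.sum_univ_three, PiLp.add_apply, PiLp.smul_apply,
        smul_eq_mul, hta]
      have hk2 : 0 < κ ^ 2 := by positivity
      rw [← mul_le_mul_iff_right₀ hk2 (b := 2 * _)]
      constructor <;> intro h <;> nlinarith
    constructor
    · intro h a ha
      exact (key (WithLp.toLp 2 fun i => κ * a i) a fun _ => rfl).1 (h _ ⟨a, ha, fun _ => rfl⟩)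
    · rintro h t ⟨a, ha, hta⟩
      exact (key t a hta).2 (h a ha)
  ext x
  constructor
  · intro hx
    have hxe : o + κ • (κ⁻¹ • (x - o)) = x := by
      rw [smul_smul, mul_inv_cancel₀ hκ.ne', one_smul, add_sub_cancel]
    exact ⟨κ⁻¹ • (x - o), (hdist _).1 (by rwa [hxe]), hxe⟩
  · rintro ⟨y, hy, rfl⟩
    exact (hdist y).2 hy

/-! ### The Gram matrix of the translation vectors of a Nielsen `ℤ⁴` -/

section Gram

variable {X : Type*} [MetricSpace X] [MulAction (MulAut (FreeGroup (Fin 3))) X]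
  {ℓ : ℝ} {b : FreeGroupBasis (Fin 3) (FreeGroup (Fin 3))} {i j k : Fin 3}
  {φ ψ θ χ : MulAut (FreeGroup (Fin 3))}

theorem tlForm_left_left
    (hℓ : ∀ b (φ : MulAut (FreeGroup (Fin 3))), IsNielsenTransformation b φ → tl X φ = ℓ)
    (hik : i ≠ k) (hφ : IsTransvection b true i j φ) (hθ : IsTransvection b true k j θ) :
    tlForm X φ θ = -(ℓ ^ 2 / 2) := by
  obtain ⟨b', h⟩ := isNielsenTransformation_left_mul_left hθ.1.symm hφ hθ hik
  rw [tlForm, hℓ _ _ h, hℓ b φ (isNielsenTransformation_iff.2 ⟨_, _, _, hφ⟩),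
    hℓ b θ (isNielsenTransformation_iff.2 ⟨_, _, _, hθ⟩)]
  ring

theorem tlForm_right_right
    (hℓ : ∀ b (φ : MulAut (FreeGroup (Fin 3))), IsNielsenTransformation b φ → tl X φ = ℓ)
    (hik : i ≠ k) (hψ : IsTransvection b false i j ψ) (hχ : IsTransvection b false k j χ) :
    tlForm X ψ χ = -(ℓ ^ 2 / 2) := by
  obtain ⟨b', h⟩ := isNielsenTransformation_right_mul_right hχ.1.symm hψ hχ hik
  rw [tlForm, hℓ _ _ h, hℓ b ψ (isNielsenTransformation_iff.2 ⟨_, _, _, hψ⟩),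
    hℓ b χ (isNielsenTransformation_iff.2 ⟨_, _, _, hχ⟩)]
  ring

theorem tlForm_left_right [CompleteSpace X] (hX : IsCAT0 X)
    (hiso : ∀ g : MulAut (FreeGroup (Fin 3)), Isometry (fun x : X => g • x))
    (hne : ∀ g : MulAut (FreeGroup (Fin 3)), (minSet (fun x : X => g • x)).Nonempty)
    (hℓ : ∀ b (φ : MulAut (FreeGroup (Fin 3))), IsNielsenTransformation b φ → tl X φ = ℓ)
    (hik : i ≠ k) (hφ : IsTransvection b true i j φ)
    (hχ : IsTransvection b false k j χ) : tlForm X φ χ = ℓ ^ 2 / 2 := by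
  obtain ⟨b', h⟩ := isNielsenTransformation_left_mul_right_inv hχ.1.symm hφ hχ hik
  have h1 := tlForm_inv_right hX hiso hne (hφ.commute_of_ne hχ hik)
  rw [tlForm, tl_inv hiso, hℓ _ _ h, hℓ b φ (isNielsenTransformation_iff.2 ⟨_, _, _, hφ⟩),
    hℓ b χ (isNielsenTransformation_iff.2 ⟨_, _, _, hχ⟩)] at h1
  linarith

theorem tlForm_transvection_self {s : Bool} (hX : IsCAT0 X)
    (hiso : ∀ g : MulAut (FreeGroup (Fin 3)), Isometry (fun x : X => g • x))
    (hne : ∀ g : MulAut (FreeGroup (Fin 3)), (minSet (fun x : X => g • x)).Nonempty)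
    (hℓ : ∀ b (φ : MulAut (FreeGroup (Fin 3))), IsNielsenTransformation b φ → tl X φ = ℓ)
    (hφ : IsTransvection b s i j φ) :
    tlForm X φ φ = ℓ ^ 2 := by
  rw [tlForm_self hX hiso hne, hℓ b φ (isNielsenTransformation_iff.2 ⟨_, _, _, hφ⟩)]

/-- The two transvections of the same basis element translate in orthogonal directions. With
`γ` the inner automorphism of `b j`, an automorphism that commutes with `γ` conjugates `θ` to
`φ * θ`; hence `φ` translates orthogonally to `γ`, which is `φ ψ⁻¹ θ χ⁻¹`. -/
theorem tlForm_left_right_same [CompleteSpace X] (hX : IsCAT0 X)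
    (hiso : ∀ g : MulAut (FreeGroup (Fin 3)), Isometry (fun x : X => g • x))
    (hne : ∀ g : MulAut (FreeGroup (Fin 3)), (minSet (fun x : X => g • x)).Nonempty)
    (hℓ : ∀ b (φ : MulAut (FreeGroup (Fin 3))), IsNielsenTransformation b φ → tl X φ = ℓ)
    (hik : i ≠ k) (hφ : IsTransvection b true i j φ)
    (hψ : IsTransvection b false i j ψ) (hθ : IsTransvection b true k j θ)
    (hχ : IsTransvection b false k j χ) : tlForm X φ ψ = 0 := by
  obtain ⟨x, hx1, hx2⟩ := exists_conj_eq_mul hik hφ hθ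
  have hγ := mul_inv_mul_mul_inv_eq_conj hik hφ hψ hθ hχ
  have c1 : Commute φ ψ := hφ.commute_same hψ
  have c2 : Commute φ θ := hφ.commute_of_ne hθ hik
  have c3 : Commute φ χ := hφ.commute_of_ne hχ hik
  have c4 : Commute ψ θ := hψ.commute_of_ne hθ hik
  have c5 : Commute ψ χ := hψ.commute_of_ne hχ hik
  have c6 : Commute θ χ := hθ.commute_same hχ
  have hγφ : Commute (φ * ψ⁻¹ * (θ * χ⁻¹)) φ :=
    ((Commute.refl φ).mul_left c1.symm.inv_left).mul_left (c2.symm.mul_left c3.symm.inv_left)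
  have hγθ : Commute (φ * ψ⁻¹ * (θ * χ⁻¹)) θ :=
    (c2.mul_left c4.inv_left).mul_left ((Commute.refl θ).mul_left c6.symm.inv_left)
  have h1 := tlForm_conj (X := X) hiso x (φ * ψ⁻¹ * (θ * χ⁻¹)) θ
  rw [hγ, hx1, hx2, ← hγ, tlForm_mul_right hX hiso hne hγφ hγθ c2] at h1
  have h2 : tlForm X (φ * ψ⁻¹ * (θ * χ⁻¹)) φ = 0 := by linarith
  have c7 : Commute (φ * ψ⁻¹) (θ * χ⁻¹) :=
    (c2.mul_left c4.inv_left).mul_right (c3.mul_left c5.inv_left).inv_right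
  rw [tlForm_mul_left hX hiso hne c7
      ((Commute.refl φ).mul_left c1.symm.inv_left) (c2.symm.mul_left c3.symm.inv_left),
    tlForm_mul_left hX hiso hne c1.inv_right (Commute.refl φ) c1.symm.inv_left,
    tlForm_mul_left hX hiso hne c6.inv_right c2.symm c3.symm.inv_left,
    tlForm_inv_left hX hiso hne c1.symm, tlForm_inv_left hX hiso hne c3.symm,
    tlForm_comm c1.symm, tlForm_comm c2.symm, tlForm_comm c3.symm,
    tlForm_transvection_self hX hiso hne hℓ hφ, tlForm_left_left hℓ hik hφ hθ,
    tlForm_left_right hX hiso hne hℓ hik hφ hχ] at h2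
  linarith

end Gram

/-! ### The flat of a Nielsen `ℤ⁴` -/

theorem eq_on_closure_of_additive {G : Type*} [Group G] {S : Set G} {f g : G → ℝ}
    (hf : ∀ x ∈ Subgroup.closure S, ∀ y ∈ Subgroup.closure S, f (x * y) = f x + f y)
    (hg : ∀ x ∈ Subgroup.closure S, ∀ y ∈ Subgroup.closure S, g (x * y) = g x + g y)
    (h : ∀ x ∈ S, f x = g x) : ∀ x ∈ Subgroup.closure S, f x = g x := by
  have h1 : f 1 = 0 := by simpa using hf 1 (one_mem _) 1 (one_mem _)
  have h2 : g 1 = 0 := by simpa using hg 1 (one_mem _) 1 (one_mem _)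
  intro x hx
  induction hx using Subgroup.closure_induction with
  | mem x hx => exact h x hx
  | one => rw [h1, h2]
  | mul x y hx hy ihx ihy => rw [hf x hx y hy, hg x hx y hy, ihx, ihy]
  | inv x hx ih =>
    have h3 := hf x hx _ (inv_mem hx)
    have h4 := hg x hx _ (inv_mem hx)
    rw [mul_inv_cancel] at h3 h4
    linarith

theorem discreteTopology_of_coe_eq_scaledFcc {κ : ℝ} (hκ : 0 < κ)
    {Γ : AddSubgroup (EuclideanSpace ℝ (Fin 3))}
    (hΓ : (Γ : Set (EuclideanSpace ℝ (Fin 3))) = scaledFcc κ) : DiscreteTopology Γ := by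
  refine DiscreteTopology.of_forall_le_dist hκ fun x y hxy => ?_
  obtain ⟨a, -, ha⟩ : (x : EuclideanSpace ℝ (Fin 3)) ∈ scaledFcc κ := hΓ ▸ x.2
  obtain ⟨c, -, hc⟩ : (y : EuclideanSpace ℝ (Fin 3)) ∈ scaledFcc κ := hΓ ▸ y.2
  obtain ⟨i, hi⟩ : ∃ i, a i ≠ c i := by
    by_contra! h
    refine hxy (Subtype.ext ?_)
    ext i
    rw [ha, hc, h]
  have h1 : (1 : ℝ) ≤ |(a i : ℝ) - c i| := by exact_mod_cast Int.one_le_abs (sub_ne_zero.2 hi)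
  have h2 := PiLp.norm_apply_le ((x : EuclideanSpace ℝ (Fin 3)) - (y : EuclideanSpace ℝ (Fin 3))) i
  rw [PiLp.sub_apply, ha, hc, ← mul_sub, Real.norm_eq_abs, abs_mul, abs_of_pos hκ] at h2
  rw [Subtype.dist_eq, dist_eq_norm]
  nlinarith

theorem exists_scaledFcc_smul_near {κ : ℝ} (hκ : 0 < κ) (x : EuclideanSpace ℝ (Fin 3)) (n : ℕ) :
    ∃ y ∈ scaledFcc κ, dist x ((1 / ((n : ℝ) + 1)) • y) ≤ 4 * κ * (1 / ((n : ℝ) + 1)) := by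
  have hn : (0 : ℝ) < (n : ℝ) + 1 := by positivity
  set a : Fin 3 → ℤ := fun i => 2 * ⌊((n : ℝ) + 1) * x i / (2 * κ)⌋ with ha
  refine ⟨WithLp.toLp 2 fun i => κ * a i, ⟨a, ?_, fun i => rfl⟩, ?_⟩
  · simp only [ha, ← mul_add, even_two_mul]
  · have hi : ∀ i, (x i - 1 / ((n : ℝ) + 1) * (κ * a i)) ^ 2 ≤
        (2 * κ * (1 / ((n : ℝ) + 1))) ^ 2 := by
      intro i
      have h1 := Int.floor_le (((n : ℝ) + 1) * x i / (2 * κ))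
      have h2 := (Int.lt_floor_add_one (((n : ℝ) + 1) * x i / (2 * κ))).le
      rw [le_div_iff₀ (by positivity)] at h1
      rw [div_le_iff₀ (by positivity)] at h2
      have h3 : x i - 1 / ((n : ℝ) + 1) * (κ * a i) =
          (((n : ℝ) + 1) * x i - κ * a i) * (1 / ((n : ℝ) + 1)) := by field_simp
      rw [h3, mul_pow, mul_pow _ (1 / ((n : ℝ) + 1))]
      refine mul_le_mul_of_nonneg_right ?_ (by positivity)
      have h4 : (a i : ℝ) = 2 * (⌊((n : ℝ) + 1) * x i / (2 * κ)⌋ : ℝ) := by simp [ha]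
      rw [h4]
      apply sq_le_sq' <;> nlinarith
    refine abs_le_of_sq_le_sq' ?_ (by positivity) |>.2
    rw [EuclideanSpace.dist_sq_eq]
    simp only [Real.dist_eq, sq_abs, Fin.sum_univ_three, PiLp.smul_apply, smul_eq_mul]
    have h5 : 0 ≤ (2 * κ * (1 / ((n : ℝ) + 1))) ^ 2 := sq_nonneg _
    have h0 := hi 0
    have h1 := hi 1
    have h2 := hi 2
    nlinarith

theorem denseRange_smul_of_range_eq_scaledFcc {K : Type*} {κ : ℝ} (hκ : 0 < κ)
    {f : K → EuclideanSpace ℝ (Fin 3)} (hf : Set.range f = scaledFcc κ) :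
    DenseRange fun a : K × ℕ => (1 / ((a.2 : ℝ) + 1)) • f a.1 := by
  rw [Metric.denseRange_iff]
  intro x r hr
  have h0 := (tendsto_one_div_add_atTop_nhds_zero_nat (𝕜 := ℝ)).const_mul (4 * κ)
  rw [mul_zero] at h0
  obtain ⟨n, hn⟩ := (h0.eventually (gt_mem_nhds hr)).exists
  obtain ⟨y, hy, hxy⟩ := exists_scaledFcc_smul_near hκ x n
  rw [← hf] at hy
  obtain ⟨h, rfl⟩ := hy
  exact ⟨(h, n), hxy.trans_lt hn⟩

/-- A homomorphism to `ℝ³` that maps four generators to the indicated vectors has the scaled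
face-centred cubic lattice as its range. -/
theorem range_eq_scaledFcc {A : Type*} [AddGroup A] {κ : ℝ}
    (τ : A →+ EuclideanSpace ℝ (Fin 3)) {u v w z : A}
    (hgen : AddSubgroup.closure {u, v, w, z} = ⊤) (hu : τ u = !₂[κ, κ, 0])
    (hv : τ v = !₂[-κ, κ, 0]) (hw : τ w = !₂[-κ, 0, κ]) (hz : τ z = !₂[κ, 0, κ]) :
    Set.range τ = scaledFcc κ := by
  apply Set.Subset.antisymm
  · rintro _ ⟨x, rfl⟩
    have hx : x ∈ AddSubgroup.closure {u, v, w, z} := hgen ▸ AddSubgroup.mem_top x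
    induction hx using AddSubgroup.closure_induction with
    | mem x hx =>
      rcases hx with rfl | rfl | rfl | rfl
      · refine ⟨![1, 1, 0], by decide, fun i => ?_⟩
        rw [hu]
        fin_cases i <;> simp
      · refine ⟨![-1, 1, 0], by decide, fun i => ?_⟩
        rw [hv]
        fin_cases i <;> simp
      · refine ⟨![-1, 0, 1], by decide, fun i => ?_⟩
        rw [hw]
        fin_cases i <;> simp
      · refine ⟨![1, 0, 1], by decide, fun i => ?_⟩
        rw [hz]
        fin_cases i <;> simp
    | zero => exact ⟨0, by simp, by simp⟩
    | add x y _ _ hx hy =>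
      obtain ⟨a, ⟨m, hm⟩, hxa⟩ := hx
      obtain ⟨c, ⟨n, hn⟩, hyc⟩ := hy
      refine ⟨a + c, ⟨m + n, ?_⟩, fun i => ?_⟩
      · simp only [Pi.add_apply]
        omega
      · rw [map_add, PiLp.add_apply, hxa, hyc]
        simp [mul_add]
    | neg x _ hx =>
      obtain ⟨a, ⟨m, hm⟩, hxa⟩ := hx
      refine ⟨-a, ⟨-m, ?_⟩, fun i => ?_⟩
      · simp only [Pi.neg_apply]
        omega
      · rw [map_neg, PiLp.neg_apply, hxa]
        simp
  · rintro x ⟨a, ⟨m, hm⟩, hx⟩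
    -- `u`, `v` and `z` already generate: their coefficients are found from the second, third and
    -- first coordinates, using that the coordinate sum is `2 * m`.
    refine ⟨(m - a 2) • u + (a 1 - m + a 2) • v + a 2 • z, ?_⟩
    have hm' : (a 0 : ℝ) + a 1 + a 2 = m + m := by exact_mod_cast hm
    simp only [map_add, map_zsmul, hu, hv, hz]
    ext i
    rw [hx]
    simp only [PiLp.add_apply, ← Int.cast_smul_eq_zsmul ℝ, PiLp.smul_apply, smul_eq_mul]
    fin_cases i <;> simp
    · linear_combination (-κ) * hm'
    · ring
    · ring

/-- If the common translation length `ℓ` of the Nielsen transformations is positive, then a Nielsen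
`ℤ⁴` acts on a three-dimensional flat by the translations of a face-centred cubic lattice. -/
theorem IsNielsenZ4.exists_flat {X : Type*} [MetricSpace X] [CompleteSpace X] (hX : IsCAT0 X)
    [MulAction (MulAut (FreeGroup (Fin 3))) X]
    (hiso : ∀ g : MulAut (FreeGroup (Fin 3)), Isometry (fun x : X => g • x))
    (hne : ∀ g : MulAut (FreeGroup (Fin 3)), (minSet (fun x : X => g • x)).Nonempty)
    {ℓ : ℝ} (hpos : 0 < ℓ)
    (hℓ : ∀ b (φ : MulAut (FreeGroup (Fin 3))), IsNielsenTransformation b φ → tl X φ = ℓ)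
    {H : Subgroup (MulAut (FreeGroup (Fin 3)))} (hH : IsNielsenZ4 H) :
    ∃ (ι : EuclideanSpace ℝ (Fin 3) → X) (τ : Additive H →+ EuclideanSpace ℝ (Fin 3)) (κ : ℝ),
      Isometry ι ∧
      (∀ (h : H) (x : EuclideanSpace ℝ (Fin 3)),
        (h : MulAut (FreeGroup (Fin 3))) • ι x = ι (x + τ (Additive.ofMul h))) ∧
      0 < κ ∧ Set.range τ = scaledFcc κ := by
  obtain ⟨b, i, j, k, φ, ψ, θ, χ, hik, hφ, hψ, hθ, hχ, hHS⟩ := hH.exists_generators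
  obtain ⟨-, ⟨e⟩⟩ := hH
  have hc : ∀ g ∈ H, ∀ h ∈ H, Commute g h := by
    intro g hg h hh
    have h1 : (⟨g, hg⟩ : H) * ⟨h, hh⟩ = ⟨h, hh⟩ * ⟨g, hg⟩ :=
      e.injective (by rw [map_mul, map_mul, mul_comm])
    exact congrArg Subtype.val h1
  subst hHS
  set S : Set (MulAut (FreeGroup (Fin 3))) := {φ, ψ, θ, χ} with hS
  set H := Subgroup.closure S with hH
  have mφ : φ ∈ H := Subgroup.subset_closure (by simp [hS])
  have mψ : ψ ∈ H := Subgroup.subset_closure (by simp [hS])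
  have mθ : θ ∈ H := Subgroup.subset_closure (by simp [hS])
  have mχ : χ ∈ H := Subgroup.subset_closure (by simp [hS])
  obtain ⟨p, hp⟩ := exists_mem_minSet_closure hX hiso hne (S := S) (by simp [hS]) hc
  -- The bilinear form on `H` and its Gram matrix.
  set B := tlForm (G := MulAut (FreeGroup (Fin 3))) X with hB
  have Bl : ∀ x ∈ H, ∀ y ∈ H, ∀ z ∈ H, B (x * y) z = B x z + B y z := fun x hx y hy z hz =>
    tlForm_mul_left hX hiso hne (hc x hx y hy) (hc x hx z hz) (hc y hy z hz)
  have Br : ∀ x ∈ H, ∀ y ∈ H, ∀ z ∈ H, B x (y * z) = B x y + B x z := fun x hx y hy z hz =>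
    tlForm_mul_right hX hiso hne (hc x hx y hy) (hc x hx z hz) (hc y hy z hz)
  have Bi : ∀ x ∈ H, ∀ y ∈ H, B x y⁻¹ = -B x y := fun x hx y hy =>
    tlForm_inv_right hX hiso hne (hc x hx y hy)
  have Bc : ∀ x ∈ H, ∀ y ∈ H, B x y = B y x := fun x hx y hy => tlForm_comm (hc x hx y hy)
  have gφφ : B φ φ = ℓ ^ 2 := tlForm_transvection_self hX hiso hne hℓ hφ
  have gψψ : B ψ ψ = ℓ ^ 2 := tlForm_transvection_self hX hiso hne hℓ hψ
  have gθθ : B θ θ = ℓ ^ 2 := tlForm_transvection_self hX hiso hne hℓ hθ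
  have gχχ : B χ χ = ℓ ^ 2 := tlForm_transvection_self hX hiso hne hℓ hχ
  have gφψ : B φ ψ = 0 := tlForm_left_right_same hX hiso hne hℓ hik hφ hψ hθ hχ
  have gθχ : B θ χ = 0 := tlForm_left_right_same hX hiso hne hℓ hik.symm hθ hχ hφ hψ
  have gφθ : B φ θ = -(ℓ ^ 2 / 2) := tlForm_left_left hℓ hik hφ hθ
  have gψχ : B ψ χ = -(ℓ ^ 2 / 2) := tlForm_right_right hℓ hik hψ hχ
  have gφχ : B φ χ = ℓ ^ 2 / 2 := tlForm_left_right hX hiso hne hℓ hik hφ hχ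
  have gθψ : B θ ψ = ℓ ^ 2 / 2 := tlForm_left_right hX hiso hne hℓ hik.symm hθ hψ
  have gψφ : B ψ φ = 0 := by rw [Bc ψ mψ φ mφ, gφψ]
  have gχθ : B χ θ = 0 := by rw [Bc χ mχ θ mθ, gθχ]
  have gθφ : B θ φ = -(ℓ ^ 2 / 2) := by rw [Bc θ mθ φ mφ, gφθ]
  have gχψ : B χ ψ = -(ℓ ^ 2 / 2) := by rw [Bc χ mχ ψ mψ, gψχ]
  have gχφ : B χ φ = ℓ ^ 2 / 2 := by rw [Bc χ mχ φ mφ, gφχ]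
  have gψθ : B ψ θ = ℓ ^ 2 / 2 := by rw [Bc ψ mψ θ mθ, gθψ]
  -- The translation vectors: `φ * ψ⁻¹`, `φ * ψ`, `θ * χ` translate by `2 * κ` along the axes.
  obtain ⟨κ, hκ, hκℓ⟩ : ∃ κ : ℝ, 0 < κ ∧ ℓ ^ 2 = 2 * κ ^ 2 :=
    ⟨ℓ / √2, by positivity, by rw [div_pow, Real.sq_sqrt (by norm_num)]; ring⟩
  set T : MulAut (FreeGroup (Fin 3)) → EuclideanSpace ℝ (Fin 3) := fun h =>
    !₂[B h (φ * ψ⁻¹) / (2 * κ), B h (φ * ψ) / (2 * κ), B h (θ * χ) / (2 * κ)] with hT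
  have mφψ' := mul_mem mφ (inv_mem mψ)
  have mφψ := mul_mem mφ mψ
  have mθχ := mul_mem mθ mχ
  have Tmul : ∀ x ∈ H, ∀ y ∈ H, T (x * y) = T x + T y := by
    intro x hx y hy
    simp only [hT, Bl x hx y hy _ mφψ', Bl x hx y hy _ mφψ, Bl x hx y hy _ mθχ]
    ext i
    fin_cases i <;> simp [add_div]
  have Tgen : ∀ x ∈ H, T x = !₂[(B x φ - B x ψ) / (2 * κ), (B x φ + B x ψ) / (2 * κ),
      (B x θ + B x χ) / (2 * κ)] := by
    intro x hx
    simp only [hT, Br x hx φ mφ _ (inv_mem mψ), Br x hx φ mφ ψ mψ, Br x hx θ mθ χ mχ, Bi x hx ψ mψ,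
      sub_eq_add_neg]
  have Tφ : T φ = !₂[κ, κ, 0] := by
    rw [Tgen φ mφ, gφφ, gφψ, gφθ, gφχ, hκℓ]
    ext i
    fin_cases i <;> simp <;> field_simp
  have Tψ : T ψ = !₂[-κ, κ, 0] := by
    rw [Tgen ψ mψ, gψφ, gψψ, gψθ, gψχ, hκℓ]
    ext i
    fin_cases i <;> simp <;> field_simp
  have Tθ : T θ = !₂[-κ, 0, κ] := by
    rw [Tgen θ mθ, gθφ, gθψ, gθθ, gθχ, hκℓ]
    ext i
    fin_cases i <;> simp <;> field_simp <;> ring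
  have Tχ : T χ = !₂[κ, 0, κ] := by
    rw [Tgen χ mχ, gχφ, gχψ, gχθ, gχχ, hκℓ]
    ext i
    fin_cases i <;> simp <;> field_simp <;> ring
  have hinner : ∀ a c d a' c' d' : ℝ,
      inner ℝ (!₂[a, c, d] : EuclideanSpace ℝ (Fin 3)) !₂[a', c', d'] =
        a * a' + c * c' + d * d' := by
    intro a c d a' c' d'
    simp [PiLp.inner_apply, Fin.sum_univ_three, mul_comm]
  -- Both sides are bilinear, so it suffices to compare them on generators.
  have hform : ∀ x ∈ H, ∀ y ∈ H, inner ℝ (T x) (T y) = B x y := by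
    have hgen : ∀ x ∈ H, ∀ y ∈ S, inner ℝ (T x) (T y) = B x y := by
      intro x hx y hy
      refine eq_on_closure_of_additive (f := fun x => inner ℝ (T x) (T y)) (g := fun x => B x y)
        ?_ ?_ ?_ x hx
      · intro x hx x' hx'
        rw [Tmul x hx x' hx', inner_add_left]
      · exact fun x hx x' hx' => Bl x hx x' hx' y (Subgroup.subset_closure hy)
      · intro x hx
        rcases hx with rfl | rfl | rfl | rfl <;> rcases hy with rfl | rfl | rfl | rfl <;>
          simp only [Tφ, Tψ, Tθ, Tχ, gφφ, gφψ, gφθ, gφχ, gψφ, gψψ, gψθ, gψχ, gθφ, gθψ, gθθ, gθχ,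
            gχφ, gχψ, gχθ, gχχ, hκℓ, hinner] <;>
          ring
    intro x hx y hy
    refine eq_on_closure_of_additive (f := fun y => inner ℝ (T x) (T y)) (g := fun y => B x y)
      ?_ ?_ (hgen x hx) y hy
    · intro y hy y' hy'
      rw [Tmul y hy y' hy', inner_add_right]
    · exact fun y hy y' hy' => Br x hx y hy y' hy'
  have hnorm : ∀ x ∈ H, tl X x = ‖T x‖ := by
    intro x hx
    rw [← sq_eq_sq₀ (tl_nonneg x) (norm_nonneg _), ← real_inner_self_eq_norm_sq, hform x hx x hx]
    exact (tlForm_self hX hiso hne x).symm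
  set τ : Additive H →+ EuclideanSpace ℝ (Fin 3) := AddMonoidHom.mk' (fun h => T h.toMul)
    fun x y => Tmul _ x.toMul.2 _ y.toMul.2 with hτ
  have hclosure : AddSubgroup.closure ({Additive.ofMul ⟨φ, mφ⟩, Additive.ofMul ⟨ψ, mψ⟩,
      Additive.ofMul ⟨θ, mθ⟩, Additive.ofMul ⟨χ, mχ⟩} : Set (Additive H)) = ⊤ := by
    refine eq_top_iff.2 fun x _ => ?_
    obtain ⟨y, hy⟩ := x
    induction hy using Subgroup.closure_induction with
    | mem y hy =>
      apply AddSubgroup.subset_closure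
      rcases hy with rfl | rfl | rfl | rfl
      exacts [Or.inl rfl, Or.inr (Or.inl rfl), Or.inr (Or.inr (Or.inl rfl)),
        Or.inr (Or.inr (Or.inr rfl))]
    | one => exact zero_mem _
    | mul y z _ _ ihy ihz => exact add_mem (ihy trivial) (ihz trivial)
    | inv y _ ih => exact neg_mem (ih trivial)
  have hrange : Set.range τ = scaledFcc κ := range_eq_scaledFcc τ hclosure Tφ Tψ Tθ Tχ
  obtain ⟨ι, hι, hιτ⟩ := hX.exists_flat (K := H) (fun g => hiso g) τ p
    (fun h => (hp h h.2).trans (hnorm h h.2)) (denseRange_smul_of_range_eq_scaledFcc hκ hrange)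
  exact ⟨ι, τ, κ, hι, hιτ, hκ, hrange⟩

theorem theorem1p3 {X : Type*} [MetricSpace X] [CompleteSpace X] (hX : IsCAT0 X)
    [MulAction (MulAut (FreeGroup (Fin 3))) X]
    (hss : ∀ φ : MulAut (FreeGroup (Fin 3)), IsSemisimpleIsometry (fun x : X => φ • x)) :
    (∀ (b : FreeGroupBasis (Fin 3) (FreeGroup (Fin 3))) (φ : MulAut (FreeGroup (Fin 3))),
      IsNielsenTransformation b φ → ∃ x : X, φ • x = x) ∨
    (∀ H : Subgroup (MulAut (FreeGroup (Fin 3))), IsNielsenZ4 H →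
      ∃ (ι : EuclideanSpace ℝ (Fin 3) → X)
        (τ : Additive H →+ EuclideanSpace ℝ (Fin 3)),
        Isometry ι ∧
        (∀ (h : H) (x : EuclideanSpace ℝ (Fin 3)),
          (h : MulAut (FreeGroup (Fin 3))) • ι x = ι (x + τ (Additive.ofMul h))) ∧
        DiscreteTopology τ.range ∧
        ∀ o : EuclideanSpace ℝ (Fin 3),
          IsRhombicDodecahedron (dirichletDomain (Set.range τ) o)) := by
  have hiso : ∀ g : MulAut (FreeGroup (Fin 3)), Isometry (fun x : X => g • x) :=
    fun g => (hss g).1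
  have hne : ∀ g : MulAut (FreeGroup (Fin 3)), (minSet (fun x : X => g • x)).Nonempty :=
    fun g => (hss g).2
  by_cases hell : ∀ (b : FreeGroupBasis (Fin 3) (FreeGroup (Fin 3)))
      (φ : MulAut (FreeGroup (Fin 3))), IsNielsenTransformation b φ → tl X φ = 0
  · refine Or.inl fun b φ hφ => ?_
    obtain ⟨x, hx⟩ := hne φ
    exact ⟨x, (dist_eq_zero.1 (hx.trans (hell b φ hφ))).symm⟩
  · push Not at hell
    obtain ⟨b₀, φ₀, hφ₀, h0⟩ := hell
    have hℓ : ∀ b (φ : MulAut (FreeGroup (Fin 3))), IsNielsenTransformation b φ →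
        tl X φ = tl X φ₀ := by
      intro b φ hφ
      obtain ⟨ψ, rfl⟩ := hφ₀.conj hφ
      exact tl_conj hiso ψ φ₀
    refine Or.inr fun H hH => ?_
    obtain ⟨ι, τ, κ, hι, hιτ, hκ, hrange⟩ :=
      hH.exists_flat hX hiso hne ((tl_nonneg φ₀).lt_of_ne' h0) hℓ
    refine ⟨ι, τ, hι, hιτ, discreteTopology_of_coe_eq_scaledFcc hκ hrange, fun o => ?_⟩
    rw [hrange]
    exact isRhombicDodecahedron_dirichletDomain_scaledFcc hκ o
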